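/- Fix a finite $n\ge 2$ (regarded as the set $\{0,\dots,n-1\}$). We consider algebras $\mathfrak A=\langle A,+,\cdot,-,0,1,c_i,d_{ij}\rangle_{i,j\in n}$, where $c_i$ is unary and $d_{ij}$ is a constant. Put $s^i_ix=x$ and $s^i_jx=c_i(x\cdot d_{ij})$ for $i\ne j$. Let $[i/j]$ be the map $n\to n$ that sends $i$ to $j$ and fixes every other element, and let $[i,j]$ be the transposition of $i$ and $j$. The empty product is $1$. $\mathrm{RC}_n$ is the class of all such $\mathfrak A$ satisfying, for all $x,y\in A$: * (Ax0) $\langle A,+,\cdot,-,0,1\rangle$ is a Boolean algebra with $0\neq 1$. * (Ax1) $c_i0=0$ for all $i$. * (Ax2) $x\le c_ix$ for all $i$. * (Ax3) $c_i(x\cdot c_iy)=c_ix\cdot c_iy$ for all $i$. * (Ax4) $d_{ii}=1$ for all $i$. * (Ax5) $d_{ij}=d_{ji}$ for all $i,j$; and $d_{ik}\cdot d_{kj}\le d_{ij}$ and $d_{ij}=c_kd_{ij}$ for all $i,j,k$ with $k\ne i$ and $k\ne j$. * (Ax6) $c_i(x\cdot d_{ij})\cdot d_{ij}\le x$ for all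 $i\ne j$. * (Ax7) $\bigl(s^{i_m}_{j_m}c_{k_m}\cdots s^{i_1}_{j_1}c_{k_1}x\bigr)\cdot\prod\{d_{l\tau(l)}:l\in K\}\le c_ix$ for every $m\ge1$ and all $i,i_1,\dots,i_m,j_1,\dots,j_m,k_1,\dots,k_m\in n$ such that $k_{t+1}\notin\{([i_t/j_t]\circ\cdots\circ[i_1/j_1])(l):l\in K\}$ for all $0\le t<m$ (for $t=0$ the empty composition is the identity), where $\tau=[i_m/j_m]\circ\cdots\circ[i_1/j_1]$ and $K=\{i_1,\dots,i_m,k_1,\dots,k_m\}\setminus\{i\}$. $\mathrm{DC}_n$ is the class of all $\mathfrak A\in\mathrm{RC}_n$ satisfying: * (Ax8) $c_jc_ix\cdot d_{jk}\le c_ic_jx$ for all $i,j,k$ with $k\ne i$ and $k\neq j$. * (Ax9) $d_{ij}=c_k(d_{ik}\cdot d_{kj})$ for all $i,j,k$ with $k\ne i$ and $k\neq j$. * (Ax10) $s^k_is^i_js^j_ms^m_kc_kx=s^k_ms^m_is^i_js^j_kc_kx$ for all $i,j,k,m$ with $k\notin\{i,j,m\}$ and $m\notin\{i,j\}$. $\mathrm{SC}_n$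 is the class of all $\mathfrak A\in\mathrm{DC}_n$ satisfying (Ax11) if $n=2$, and (Ax12) if $n\ge3$: * (Ax11) $x\cdot-d_{01}\le c_0c_1(-d_{01}\cdot s^0_1c_1x\cdot s^1_0c_0x)$. * (Ax12) $x\le c_ic_j\bigl(s^i_jc_jx\cdot s^j_ic_ix\cdot\prod_{k\ne i,j}s^k_is^i_js^j_kc_kx\bigr)$ for all $i,j$. For a set $V$ of sequences of length $n$, let $\mathfrak P(V)=\langle\mathcal P(V),\cup,\cap,\setminus,\emptyset,V,C_i,D_{ij}\rangle_{i,j\in n}$, where $\setminus$ is complementation relative to $V$, $C_iX$ is the set of all $f\in V$ that agree with some $g\in X$ at every place except possibly $i$, and $D_{ij}=\{f\in V:f(i)=f(j)\}$. Let $\mathrm{RCs}_n$ be the class of all subalgebras of algebras $\mathfrak P(V)$ with $V\ne\emptyset$. Let $\mathrm{DCs}_n$ be the class of those for which moreover $V$ is diagonalizable, i.e. $f\circ[i/j]\in V$ for all $f\in V$ and $i,j\in n$. Let $\mathrm{SCs}_n$ be the class of those for which moreover $V$ is diagonalizable and permutable, the latter meaning $f\circ[i,j]\in V$ for all $f\in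 V$ and $i,j\in n$. Write $\mathbf I\mathrm L$ for the class of all isomorphic copies of members of $\mathrm L$. **Theorem.** For every finite $n\ge2$, $$\mathrm{RC}_n=\mathbf I\,\mathrm{RCs}_n,\qquad \mathrm{DC}_n=\mathbf I\,\mathrm{DCs}_n,\qquad \mathrm{SC}_n=\mathbf I\,\mathrm{SCs}_n .$$ -/

import Mathlib

universe u v

/-- An algebra `⟨A, +, ·, -, 0, 1, c_i, d_ij⟩` (`i, j < n`) of cylindric type of dimension `n`.
This is only the similarity type; all the laws are stated in `IsRC`, `IsDC` and `IsSC`. -/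
structure CylAlg (n : ℕ) : Type (u + 1) where
  carrier : Type u
  add : carrier → carrier → carrier
  mul : carrier → carrier → carrier
  neg : carrier → carrier
  zero : carrier
  one : carrier
  c : Fin n → carrier → carrier
  d : Fin n → Fin n → carrier

/-- The transformation `[i/j]` of `n`: it sends `i` to `j` and fixes everything else. -/
def repl {n : ℕ} (i j : Fin n) : Fin n → Fin n := Function.update id i j

/-- `[i_t/j_t] ∘ ⋯ ∘ [i_1/j_1]`, where `i_1, i_2, …` are `i 0, i 1, …`, and likewise for `j`. -/
def replComp {n : ℕ} (i j : ℕ → Fin n) : ℕ → Fin n → Fin n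
  | 0 => id
  | t + 1 => repl (i t) (j t) ∘ replComp i j t

namespace CylAlg

variable {n : ℕ}

/-- The order of the Boolean reduct: `x ≤ y` means `x · y = x`. -/
def le (A : CylAlg.{u} n) (x y : A.carrier) : Prop := A.mul x y = x

/-- The finite product `∏ {f l : l ∈ K}`; the empty product is `1`. -/
def prod (A : CylAlg.{u} n) (K : Finset (Fin n)) (f : Fin n → A.carrier) : A.carrier :=
  (((List.finRange n).filter (fun l => l ∈ K)).map f).foldr A.mul A.one

/-- The substitution `s^i_j`: `s^i_i x = x`, and `s^i_j x = c_i (x · d_ij)` for `i ≠ j`. -/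
def s (A : CylAlg.{u} n) (i j : Fin n) (x : A.carrier) : A.carrier :=
  if i = j then x else A.c i (A.mul x (A.d i j))

/-- `s^{i_m}_{j_m} c_{k_m} ⋯ s^{i_1}_{j_1} c_{k_1} x`, where `i_1, i_2, …` are `i 0, i 1, …`,
and likewise for `j` and `k`. -/
def word (A : CylAlg.{u} n) (i j k : ℕ → Fin n) (x : A.carrier) : ℕ → A.carrier
  | 0 => x
  | m + 1 => A.s (i m) (j m) (A.c (k m) (A.word i j k x m))

/-- `⟨A, +, ·, -, 0, 1⟩` is a Boolean algebra with `0 ≠ 1`. -/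
def IsBoolean (A : CylAlg.{u} n) : Prop :=
  A.zero ≠ A.one ∧
  ∃ _inst : BooleanAlgebra A.carrier,
    (∀ x y, A.add x y = x ⊔ y) ∧ (∀ x y, A.mul x y = x ⊓ y) ∧ (∀ x, A.neg x = xᶜ) ∧
    A.zero = ⊥ ∧ A.one = ⊤

/-- The axioms of the class `RC_n`. -/
structure IsRC (A : CylAlg.{u} n) : Prop where
  ax0 : A.IsBoolean
  ax1 : ∀ i, A.c i A.zero = A.zero
  ax2 : ∀ i x, A.le x (A.c i x)
  ax3 : ∀ i x y, A.c i (A.mul x (A.c i y)) = A.mul (A.c i x) (A.c i y)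
  ax4 : ∀ i, A.d i i = A.one
  ax5_symm : ∀ i j, A.d i j = A.d j i
  ax5_trans : ∀ i j k, k ≠ i → k ≠ j → A.le (A.mul (A.d i k) (A.d k j)) (A.d i j)
  ax5_cyl : ∀ i j k, k ≠ i → k ≠ j → A.d j i = A.c k (A.d j i)
  ax6 : ∀ i j x, i ≠ j → A.le (A.mul (A.c i (A.mul x (A.d i j))) (A.d i j)) x
  /-- `K = {i_1, …, i_m, k_1, …, k_m} \ {i₀}`, and the requirement on `k_{t+1}` is made for all
  `0 ≤ t < m`. -/
  ax7 : ∀ (m : ℕ) (i j k : ℕ → Fin n) (i₀ : Fin n) (K : Finset (Fin n)), 1 ≤ m →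
    K = ((Finset.range m).image i ∪ (Finset.range m).image k).erase i₀ →
    (∀ t < m, k t ∉ K.image (replComp i j t)) →
    ∀ x, A.le (A.mul (A.word i j k x m) (A.prod K fun l => A.d l (replComp i j m l))) (A.c i₀ x)

/-- The axioms of the class `DC_n`. -/
structure IsDC (A : CylAlg.{u} n) : Prop extends IsRC A where
  ax8 : ∀ i j k x, k ≠ i → k ≠ j →
    A.le (A.mul (A.c j (A.c i x)) (A.d j k)) (A.c i (A.c j x))
  ax9 : ∀ i j k, k ≠ i → k ≠ j → A.d i j = A.c k (A.mul (A.d i k) (A.d k j))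
  ax10 : ∀ i j k m x, k ≠ i → k ≠ j → k ≠ m → m ≠ i → m ≠ j →
    A.s k i (A.s i j (A.s j m (A.s m k (A.c k x)))) =
      A.s k m (A.s m i (A.s i j (A.s j k (A.c k x))))

/-- The axioms of the class `SC_n`: axiom 11 is for `n = 2` only, axiom 12 for `n ≥ 3` only. -/
structure IsSC (A : CylAlg.{u} n) : Prop extends IsDC A where
  ax11 : n = 2 → ∀ i j : Fin n, (i : ℕ) = 0 → (j : ℕ) = 1 → ∀ x,
    A.le (A.mul x (A.neg (A.d i j)))
      (A.c i (A.c j (A.mul (A.mul (A.neg (A.d i j)) (A.s i j (A.c j x))) (A.s j i (A.c i x)))))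
  ax12 : 3 ≤ n → ∀ i j x,
    A.le x (A.c i (A.c j (A.mul (A.mul (A.s i j (A.c j x)) (A.s j i (A.c i x)))
      (A.prod (Finset.univ.filter fun k => k ≠ i ∧ k ≠ j)
        fun k => A.s k i (A.s i j (A.s j k (A.c k x)))))))

/-- Isomorphisms of algebras of cylindric type. -/
structure Iso (A : CylAlg.{u} n) (B : CylAlg.{v} n) extends A.carrier ≃ B.carrier where
  map_add : ∀ x y, toFun (A.add x y) = B.add (toFun x) (toFun y)
  map_mul : ∀ x y, toFun (A.mul x y) = B.mul (toFun x) (toFun y)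
  map_neg : ∀ x, toFun (A.neg x) = B.neg (toFun x)
  map_zero : toFun A.zero = B.zero
  map_one : toFun A.one = B.one
  map_c : ∀ i x, toFun (A.c i x) = B.c i (toFun x)
  map_d : ∀ i j, toFun (A.d i j) = B.d i j

/-- Universes of subalgebras. -/
structure Subuniverse (A : CylAlg.{u} n) where
  set : Set A.carrier
  add_mem : ∀ {x y}, x ∈ set → y ∈ set → A.add x y ∈ set
  mul_mem : ∀ {x y}, x ∈ set → y ∈ set → A.mul x y ∈ set
  neg_mem : ∀ {x}, x ∈ set → A.neg x ∈ set
  zero_mem : A.zero ∈ set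
  one_mem : A.one ∈ set
  c_mem : ∀ i {x}, x ∈ set → A.c i x ∈ set
  d_mem : ∀ i j, A.d i j ∈ set

/-- The subalgebra with a given universe. -/
def Subuniverse.toCylAlg {A : CylAlg.{u} n} (S : A.Subuniverse) : CylAlg.{u} n where
  carrier := S.set
  add x y := ⟨A.add x y, S.add_mem x.2 y.2⟩
  mul x y := ⟨A.mul x y, S.mul_mem x.2 y.2⟩
  neg x := ⟨A.neg x, S.neg_mem x.2⟩
  zero := ⟨A.zero, S.zero_mem⟩
  one := ⟨A.one, S.one_mem⟩
  c i x := ⟨A.c i x, S.c_mem i x.2⟩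
  d i j := ⟨A.d i j, S.d_mem i j⟩

/-- `g ≡_i f`: the sequence `g` is `f(i/w)` for some `w`. -/
def AgreeOff {U : Type v} (i : Fin n) (g f : Fin n → U) : Prop :=
  ∃ w : U, g = Function.update f i w

/-- The full algebra `𝔓(V)` of all subsets of a set `V` of sequences of length `n`. -/
def full {U : Type v} (V : Set (Fin n → U)) : CylAlg.{v} n where
  carrier := Set V
  add X Y := X ∪ Y
  mul X Y := X ∩ Y
  neg X := Xᶜ
  zero := ∅
  one := Set.univ
  c i X := {f | ∃ g ∈ X, AgreeOff i (f : Fin n → U) (g : Fin n → U)}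
  d i j := {f | (f : Fin n → U) i = (f : Fin n → U) j}

/-- `V` is diagonalizable. -/
def Diagonalizable {U : Type v} (V : Set (Fin n → U)) : Prop :=
  ∀ f ∈ V, ∀ i j : Fin n, f ∘ repl i j ∈ V

/-- `V` is permutable. -/
def Permutable {U : Type v} (V : Set (Fin n → U)) : Prop :=
  ∀ f ∈ V, ∀ i j : Fin n, f ∘ Equiv.swap i j ∈ V

variable (n)

/-- The class `RC_n`. -/
def RC : Set (CylAlg.{u} n) := {A | A.IsRC}

/-- The class `DC_n`. -/
def DC : Set (CylAlg.{u} n) := {A | A.IsDC}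

/-- The class `SC_n`. -/
def SC : Set (CylAlg.{u} n) := {A | A.IsSC}

/-- The class `RCs_n` of relativized cylindric set algebras: all subalgebras of full algebras
`𝔓(V)` with `V` non-empty. -/
def RCs : Set (CylAlg.{v} n) :=
  {B | ∃ (U : Type v) (V : Set (Fin n → U)), V.Nonempty ∧
    ∃ S : (full V).Subuniverse, B = S.toCylAlg}

/-- The class `DCs_n` of diagonalizable cylindric set algebras. -/
def DCs : Set (CylAlg.{v} n) :=
  {B | ∃ (U : Type v) (V : Set (Fin n → U)), V.Nonempty ∧ Diagonalizable V ∧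
    ∃ S : (full V).Subuniverse, B = S.toCylAlg}

/-- The class `SCs_n` of locally square cylindric set algebras. -/
def SCs : Set (CylAlg.{v} n) :=
  {B | ∃ (U : Type v) (V : Set (Fin n → U)), V.Nonempty ∧ Diagonalizable V ∧ Permutable V ∧
    ∃ S : (full V).Subuniverse, B = S.toCylAlg}

variable {n}

/-- The class `𝐈 𝒦` of all isomorphic copies of members of `𝒦`. -/
def isoCopies (𝒦 : Set (CylAlg.{v} n)) : Set (CylAlg.{u} n) :=
  {A | ∃ B ∈ 𝒦, Nonempty (Iso A B)}

end CylAlg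

/-! Right to left, the axioms are checked in a representation: `f` lies in `s^i_j x` iff `f ∈ V` and
`f ∘ [i/j]` lies in `x`, so each axiom becomes a fact about sequences composed with maps.

Left to right, the ultrafilters of the algebra form a frame, in which Ax7 turns into the condition
`Frame.merry`. This frame is unravelled into a tree. Each node carries a label and a sequence of
formal terms; a change at `i` reuses an old term if the new world identifies `i` with another
coordinate, and otherwise creates a term tagged by the new node. The crux is that sequences agreeing
off `i` have `E i`-related labels (`Node.rel_of_eqOff`). Let `T` be the set of their common values
off `i`. Climbing down from the higher of the two nodes never undoes the creation of a value in `T`,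
so the nodes are joined by a chain of changes each keeping `T` (`Node.conn_of_subset_range`).
Recording where these values sit along the chain yields a word of free changes and substitutions
(`Conn.exists_merryWord`), to which `merry` applies.

For DC, Ax9 supplies a world for every substitution. For SC, all rearrangements of injective
sequences are added, with worlds supplied by Ax11 or Ax12. Since `T` has at most `n - 1` values, an
injective sequence has a place whose value is not needed, and through it a swap becomes a chain of
changes keeping `T` (`IsSwap.conn`). -/

theorem repl_apply {n : ℕ} (i j l : Fin n) : repl i j l = if l = i then j else l := by
  simp [repl, Function.update_apply]

theorem repl_self {n : ℕ} (i : Fin n) : repl i i = id := by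
  simp [repl]

/-! ### Representations and soundness of the axioms -/

namespace CylAlg

variable {n : ℕ}

/-- The sequences `f` and `g` agree at every place except possibly `i`. -/
def EqOff {U : Type v} (i : Fin n) (f g : Fin n → U) : Prop := ∀ l, l ≠ i → f l = g l

theorem agreeOff_iff_eqOff {U : Type v} {i : Fin n} {f g : Fin n → U} :
    AgreeOff i f g ↔ EqOff i f g := by
  constructor
  · rintro ⟨w, rfl⟩ l hl
    simp [hl]
  · intro h
    refine ⟨f i, funext fun l => ?_⟩
    by_cases hl : l = i
    · subst hl; simp
    · simp [hl, h l hl]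

/-- `Φ` embeds `A` into the full algebra of subsets of `V`. -/
structure IsRep (A : CylAlg.{u} n) {U : Type v} (V : Set (Fin n → U))
    (Φ : A.carrier → Set (Fin n → U)) : Prop where
  inj : Function.Injective Φ
  sub : ∀ x, Φ x ⊆ V
  map_add : ∀ x y, Φ (A.add x y) = Φ x ∪ Φ y
  map_mul : ∀ x y, Φ (A.mul x y) = Φ x ∩ Φ y
  map_neg : ∀ x, Φ (A.neg x) = V \ Φ x
  map_zero : Φ A.zero = ∅
  map_one : Φ A.one = V
  map_c : ∀ i x, Φ (A.c i x) = {f | f ∈ V ∧ ∃ g ∈ Φ x, EqOff i f g}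
  map_d : ∀ i j, Φ (A.d i j) = {f | f ∈ V ∧ f i = f j}

/-- The class of isomorphic copies of the subalgebras of `𝔓(V)`, for non-empty `V` with the
property `P`, is the class of algebras with a representation on such a `V`. -/
theorem mem_isoCopies_iff (P : ∀ U : Type v, Set (Fin n → U) → Prop) (A : CylAlg.{u} n) :
    A ∈ isoCopies {B : CylAlg.{v} n | ∃ (U : Type v) (V : Set (Fin n → U)), V.Nonempty ∧ P U V ∧
      ∃ S : (full V).Subuniverse, B = S.toCylAlg} ↔
    ∃ (U : Type v) (V : Set (Fin n → U)), V.Nonempty ∧ P U V ∧ ∃ Φ, IsRep A V Φ := by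
  constructor
  · rintro ⟨B, ⟨U, V, hV, hP, S, rfl⟩, ⟨φ⟩⟩
    let ψ : A.carrier → Set V := fun x => (φ.toFun x).1
    refine ⟨U, V, hV, hP, fun x => Subtype.val '' ψ x, ?_⟩
    constructor
    · intro x y hxy
      exact φ.toEquiv.injective (Subtype.ext (Subtype.val_injective.image_injective hxy))
    · rintro x _ ⟨f, -, rfl⟩
      exact f.2
    · intro x y
      have : ψ (A.add x y) = ψ x ∪ ψ y := congrArg Subtype.val (φ.map_add x y)
      simp only [this, Set.image_union]
    · intro x y
      have : ψ (A.mul x y) = ψ x ∩ ψ y := congrArg Subtype.val (φ.map_mul x y)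
      simp only [this, Set.image_inter Subtype.val_injective]
    · intro x
      have : ψ (A.neg x) = (ψ x)ᶜ := congrArg Subtype.val (φ.map_neg x)
      simp only [this, Set.compl_eq_univ_sdiff, Set.image_sdiff Subtype.val_injective,
        Set.image_univ, Subtype.range_coe_subtype, Set.ofPred_mem_eq]
    · have : ψ A.zero = ∅ := congrArg Subtype.val φ.map_zero
      simp only [this, Set.image_empty]
    · have : ψ A.one = Set.univ := congrArg Subtype.val φ.map_one
      simp only [this, Set.image_univ, Subtype.range_coe_subtype, Set.ofPred_mem_eq]
    · intro i x
      have : ψ (A.c i x) = {f : V | ∃ g ∈ ψ x, AgreeOff i (f : Fin n → U) (g : Fin n → U)} :=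
        congrArg Subtype.val (φ.map_c i x)
      ext f
      simpa [this, agreeOff_iff_eqOff] using and_comm
    · intro i j
      have : ψ (A.d i j) = {f : V | (f : Fin n → U) i = (f : Fin n → U) j} :=
        congrArg Subtype.val (φ.map_d i j)
      ext f
      simpa [this] using and_comm
  · rintro ⟨U, V, hV, hP, Φ, h⟩
    let ψ : A.carrier → Set V := fun x => Subtype.val ⁻¹' Φ x
    have inj : Function.Injective ψ := by
      intro x y hxy
      apply h.inj
      ext f
      constructor
      · intro hf
        have : (⟨f, h.sub _ hf⟩ : V) ∈ ψ x := hf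
        rw [hxy] at this
        exact this
      · intro hf
        have : (⟨f, h.sub _ hf⟩ : V) ∈ ψ y := hf
        rw [← hxy] at this
        exact this
    have hadd : ∀ x y, ψ (A.add x y) = ψ x ∪ ψ y := fun x y => by
      simp only [ψ, h.map_add, Set.preimage_union]
    have hmul : ∀ x y, ψ (A.mul x y) = ψ x ∩ ψ y := fun x y => by
      simp only [ψ, h.map_mul, Set.preimage_inter]
    have hneg : ∀ x, ψ (A.neg x) = (ψ x)ᶜ := fun x => by
      ext f; simp [ψ, h.map_neg]
    have hzero : ψ A.zero = ∅ := by simp [ψ, h.map_zero]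
    have hone : ψ A.one = Set.univ := by ext f; simp [ψ, h.map_one]
    have hc : ∀ i x, ψ (A.c i x) =
        {f : V | ∃ g ∈ ψ x, AgreeOff i (f : Fin n → U) (g : Fin n → U)} := fun i x => by
      ext f
      simp only [ψ, h.map_c, agreeOff_iff_eqOff, Set.mem_preimage, Set.mem_ofPred_eq]
      constructor
      · rintro ⟨-, g, hg, e⟩
        exact ⟨⟨g, h.sub _ hg⟩, hg, e⟩
      · rintro ⟨g, hg, e⟩
        exact ⟨f.2, g, hg, e⟩
    have hd : ∀ i j, ψ (A.d i j) = {f : V | (f : Fin n → U) i = (f : Fin n → U) j} := fun i j => by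
      ext f; simp [ψ, h.map_d]
    let S : (full V).Subuniverse :=
      { set := Set.range ψ
        add_mem := by rintro _ _ ⟨x, rfl⟩ ⟨y, rfl⟩; exact ⟨_, hadd x y⟩
        mul_mem := by rintro _ _ ⟨x, rfl⟩ ⟨y, rfl⟩; exact ⟨_, hmul x y⟩
        neg_mem := by rintro _ ⟨x, rfl⟩; exact ⟨_, hneg x⟩
        zero_mem := ⟨_, hzero⟩
        one_mem := ⟨_, hone⟩
        c_mem := by rintro i _ ⟨x, rfl⟩; exact ⟨_, hc i x⟩
        d_mem := fun i j => ⟨_, hd i j⟩ }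
    exact ⟨S.toCylAlg, ⟨U, V, hV, hP, S, rfl⟩, ⟨{
      toEquiv := Equiv.ofInjective ψ inj
      map_add := fun x y => Subtype.ext (hadd x y)
      map_mul := fun x y => Subtype.ext (hmul x y)
      map_neg := fun x => Subtype.ext (hneg x)
      map_zero := Subtype.ext hzero
      map_one := Subtype.ext hone
      map_c := fun i x => Subtype.ext (hc i x)
      map_d := fun i j => Subtype.ext (hd i j) }⟩⟩

namespace IsRep

variable {A : CylAlg.{u} n} {U : Type v} {V : Set (Fin n → U)} {Φ : A.carrier → Set (Fin n → U)}

theorem le_iff (h : IsRep A V Φ) {x y : A.carrier} : A.le x y ↔ Φ x ⊆ Φ y := by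
  rw [CylAlg.le, ← h.inj.eq_iff, h.map_mul, Set.inter_eq_left]

theorem mem_mul (h : IsRep A V Φ) {x y : A.carrier} {f : Fin n → U} :
    f ∈ Φ (A.mul x y) ↔ f ∈ Φ x ∧ f ∈ Φ y := by
  rw [h.map_mul, Set.mem_inter_iff]

theorem mem_c (h : IsRep A V Φ) {i : Fin n} {x : A.carrier} {f : Fin n → U} :
    f ∈ Φ (A.c i x) ↔ f ∈ V ∧ ∃ g ∈ Φ x, EqOff i f g := by
  rw [h.map_c, Set.mem_ofPred_eq]

theorem mem_d (h : IsRep A V Φ) {i j : Fin n} {f : Fin n → U} :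
    f ∈ Φ (A.d i j) ↔ f ∈ V ∧ f i = f j := by
  rw [h.map_d, Set.mem_ofPred_eq]

theorem mem_s (h : IsRep A V Φ) {i j : Fin n} {x : A.carrier} {f : Fin n → U} :
    f ∈ Φ (A.s i j x) ↔ f ∈ V ∧ f ∘ repl i j ∈ Φ x := by
  by_cases hij : i = j
  · subst hij
    simp only [CylAlg.s, if_true, repl_self, Function.comp_id]
    exact ⟨fun hf => ⟨h.sub _ hf, hf⟩, fun hf => hf.2⟩
  · simp only [CylAlg.s, hij, if_false, h.mem_c, h.mem_mul, h.mem_d]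
    refine and_congr_right fun _ => ⟨?_, fun hf => ?_⟩
    · rintro ⟨g, ⟨hg, -, e⟩, hfg⟩
      convert hg
      funext l
      by_cases hl : l = i
      · subst hl
        simp [repl_apply, e, hfg _ (Ne.symm hij)]
      · simp [repl_apply, hl, hfg l hl]
    · refine ⟨_, ⟨hf, h.sub _ hf, ?_⟩, fun l hl => ?_⟩
      · simp [repl_apply]
      · simp [repl_apply, hl]

theorem mem_prod (h : IsRep A V Φ) {K : Finset (Fin n)} {F : Fin n → A.carrier} {f : Fin n → U} :
    f ∈ Φ (A.prod K F) ↔ f ∈ V ∧ ∀ l ∈ K, f ∈ Φ (F l) := by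
  have key : ∀ L : List A.carrier, f ∈ Φ (L.foldr A.mul A.one) ↔ f ∈ V ∧ ∀ x ∈ L, f ∈ Φ x := by
    intro L
    induction L with
    | nil => simp [h.map_one]
    | cons a L ih =>
      simp only [List.foldr_cons, h.mem_mul, ih, List.mem_cons, forall_eq_or_imp]
      tauto
  simp [CylAlg.prod, key]

/-- The outermost operation acts on `f` first. A substitution composes `f` with `[i/j]`, and the
following `c_k` alters only place `k`, which by hypothesis carries no value tracked from `K`. -/
theorem exists_of_mem_word (h : IsRep A V Φ) {i j k : ℕ → Fin n} {K : Finset (Fin n)}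
    {x : A.carrier} : ∀ {m : ℕ}, (∀ t < m, k t ∉ K.image (replComp i j t)) →
      ∀ {f : Fin n → U}, f ∈ Φ (A.word i j k x m) →
      ∃ g ∈ Φ x, (∀ l ∈ K, g l = f (replComp i j m l)) ∧
        ∀ l, (∀ t < m, l ≠ i t ∧ l ≠ k t) → g l = f l := by
  intro m
  induction m with
  | zero => exact fun _ f hf => ⟨f, hf, fun _ _ => rfl, fun _ _ => rfl⟩
  | succ m ih =>
    intro hk f hf
    obtain ⟨-, hf⟩ := h.mem_s.1 hf
    obtain ⟨-, g, hg, hfg⟩ := h.mem_c.1 hf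
    obtain ⟨g', hg', h1, h2⟩ := ih (fun t ht => hk t (by omega)) hg
    refine ⟨g', hg', fun l hl => ?_, fun l hl => ?_⟩
    · have hne : replComp i j m l ≠ k m := fun e =>
        hk m (by omega) (Finset.mem_image.2 ⟨l, hl, e⟩)
      rw [h1 l hl, ← hfg _ hne]
      rfl
    · rw [h2 l fun t ht => hl t (by omega), ← hfg _ (hl m (by omega)).2]
      simp [repl_apply, (hl m (by omega)).1]

theorem isBoolean (h : IsRep A V Φ) (hV : V.Nonempty) : A.IsBoolean := by
  constructor
  · intro e
    have := h.map_one
    rw [← e, h.map_zero] at this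
    exact hV.ne_empty this.symm
  · let ψ : A.carrier → Set V := fun x => Subtype.val ⁻¹' Φ x
    have hψ : ∀ x y, ψ x = ψ y → x = y := by
      intro x y e
      apply h.inj
      have := congrArg (Set.image Subtype.val) e
      simpa [ψ, Set.inter_eq_right.2 (h.sub _)] using this
    let _ : Max A.carrier := ⟨A.add⟩
    let _ : Min A.carrier := ⟨A.mul⟩
    let _ : Compl A.carrier := ⟨A.neg⟩
    let _ : Top A.carrier := ⟨A.one⟩
    let _ : Bot A.carrier := ⟨A.zero⟩
    let _ : LE A.carrier := ⟨fun x y => ψ x ≤ ψ y⟩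
    let _ : LT A.carrier := ⟨fun x y => ψ x < ψ y⟩
    let _ : SDiff A.carrier := ⟨fun x y => A.mul x (A.neg y)⟩
    let _ : HImp A.carrier := ⟨fun x y => A.add y (A.neg x)⟩
    have hadd : ∀ x y, ψ (A.add x y) = ψ x ⊔ ψ y := fun x y => by
      simp only [ψ, h.map_add, Set.preimage_union, Set.sup_eq_union]
    have hmul : ∀ x y, ψ (A.mul x y) = ψ x ⊓ ψ y := fun x y => by
      simp only [ψ, h.map_mul, Set.preimage_inter, Set.inf_eq_inter]
    have hneg : ∀ x, ψ (A.neg x) = (ψ x)ᶜ := fun x => by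
      ext f; simp [ψ, h.map_neg]
    refine ⟨Function.Injective.booleanAlgebra ψ hψ Iff.rfl Iff.rfl hadd hmul ?_ ?_ hneg ?_ ?_,
      fun _ _ => rfl, fun _ _ => rfl, fun _ => rfl, rfl, rfl⟩
    · change ψ A.one = ⊤
      ext f; simp [ψ, h.map_one]
    · change ψ A.zero = ⊥
      simp [ψ, h.map_zero]
    · intro x y
      change ψ (A.mul x (A.neg y)) = _
      rw [hmul, hneg, sdiff_eq]
    · intro x y
      change ψ (A.add y (A.neg x)) = _
      rw [hadd, hneg, himp_eq]

theorem isRC (h : IsRep A V Φ) (hV : V.Nonempty) : A.IsRC where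
  ax0 := h.isBoolean hV
  ax1 i := by
    apply h.inj
    simp [h.map_c, h.map_zero]
  ax2 i x := h.le_iff.2 fun f hf => h.mem_c.2 ⟨h.sub _ hf, f, hf, fun _ _ => rfl⟩
  ax3 i x y := by
    apply h.inj
    ext f
    simp only [h.mem_c, h.mem_mul]
    constructor
    · rintro ⟨hf, g, ⟨hg, -, g', hg', e'⟩, e⟩
      exact ⟨⟨hf, g, hg, e⟩, hf, g', hg', fun l hl => (e l hl).trans (e' l hl)⟩
    · rintro ⟨⟨hf, g, hg, e⟩, -, g', hg', e'⟩
      exact ⟨hf, g, ⟨hg, h.sub _ hg, g', hg', fun l hl => (e l hl).symm.trans (e' l hl)⟩, e⟩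
  ax4 i := by
    apply h.inj
    simp [h.map_d, h.map_one]
  ax5_symm i j := by
    apply h.inj
    simp [h.map_d, eq_comm]
  ax5_trans i j k _ _ := by
    refine h.le_iff.2 fun f hf => ?_
    simp only [h.mem_mul, h.mem_d] at hf ⊢
    exact ⟨hf.1.1, hf.1.2.trans hf.2.2⟩
  ax5_cyl i j k hi hj := by
    apply h.inj
    ext f
    simp only [h.mem_c, h.mem_d]
    constructor
    · exact fun hf => ⟨hf.1, f, hf, fun _ _ => rfl⟩
    · rintro ⟨hf, g, hg, e⟩
      exact ⟨hf, by rw [e _ hj.symm, e _ hi.symm, hg.2]⟩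
  ax6 i j x hij := by
    refine h.le_iff.2 fun f hf => ?_
    simp only [h.mem_mul, h.mem_d, h.mem_c] at hf
    obtain ⟨⟨-, g, ⟨hg, -, e'⟩, e⟩, -, hf⟩ := hf
    convert hg
    funext l
    by_cases hl : l = i
    · rw [hl, hf, e _ hij.symm, e']
    · exact e l hl
  ax7 m i j k i₀ K hm hK hk x := by
    refine h.le_iff.2 fun f hf => ?_
    simp only [h.mem_mul, h.mem_prod, h.mem_d] at hf
    obtain ⟨hf, hfV, hd⟩ := hf
    obtain ⟨g, hg, h1, h2⟩ := h.exists_of_mem_word hk hf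
    refine h.mem_c.2 ⟨hfV, g, hg, fun l hl => ?_⟩
    by_cases hlK : l ∈ K
    · rw [h1 l hlK, (hd l hlK).2]
    · refine (h2 l fun t ht => ?_).symm
      simp only [hK, Finset.mem_erase, Finset.mem_union, Finset.mem_image, Finset.mem_range] at hlK
      push Not at hlK
      exact ⟨fun e => (hlK hl).1 t ht e.symm, fun e => (hlK hl).2 t ht e.symm⟩

theorem isDC (h : IsRep A V Φ) (hV : V.Nonempty) (hD : Diagonalizable V) : A.IsDC where
  toIsRC := h.isRC hV
  ax8 i j k x hi hj := by
    refine h.le_iff.2 fun f hf => ?_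
    simp only [h.mem_mul, h.mem_d, h.mem_c] at hf ⊢
    obtain ⟨⟨hfV, g, ⟨hgV, g', hg', e'⟩, e⟩, -, hf⟩ := hf
    -- Since `f j = f k`, the sequence `g' ∘ [j/k]` gets back at `j` the value of `f`, so it differs
    -- from `f` only at `i` and from `g'` only at `j`.
    have hV' := hD g' (h.sub _ hg') j k
    refine ⟨hfV, _, ⟨hV', g', hg', fun l hl => by simp [repl_apply, hl]⟩, fun l hl => ?_⟩
    by_cases hlj : l = j
    · simp [repl_apply, hlj, ← e' k hi, ← e k hj, hf]
    · simp [repl_apply, hlj, ← e' l hl, ← e l hlj]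
  ax9 i j k hi hj := by
    apply h.inj
    ext f
    simp only [h.mem_mul, h.mem_d, h.mem_c]
    constructor
    · rintro ⟨hf, e⟩
      have := hD f hf k i
      exact ⟨hf, _, ⟨⟨this, by simp [repl_apply]⟩, this,
        by simp [repl_apply, hj.symm, e]⟩, fun l hl => by simp [repl_apply, hl]⟩
    · rintro ⟨hf, g, ⟨⟨-, h1⟩, -, h2⟩, e⟩
      exact ⟨hf, by rw [e _ hi.symm, e _ hj.symm, h1, h2]⟩
  ax10 i j k m x hki hkj hkm hmi hmj := by
    have hx : ∀ f g, EqOff k f g → f ∈ V → g ∈ Φ (A.c k x) → f ∈ Φ (A.c k x) := by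
      intro f g e hf hg
      obtain ⟨-, g', hg', e'⟩ := h.mem_c.1 hg
      exact h.mem_c.2 ⟨hf, g', hg', fun l hl => (e l hl).trans (e' l hl)⟩
    apply h.inj
    ext f
    simp only [h.mem_s]
    -- Both compositions rearrange the places `i`, `j`, `m` in the same way with `k` as scratch
    -- place, so they can differ only at `k`, where `c_k x` is insensitive.
    have e : EqOff k ((((f ∘ repl k i) ∘ repl i j) ∘ repl j m) ∘ repl m k)
        ((((f ∘ repl k m) ∘ repl m i) ∘ repl i j) ∘ repl j k) := by
      intro l hl
      simp only [Function.comp_apply, repl_apply]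
      congr 1
      grind
    constructor
    · rintro ⟨hf, -, -, -, h4⟩
      have m1 := hD _ hf k m
      have m2 := hD _ m1 m i
      have m3 := hD _ m2 i j
      have m4 := hD _ m3 j k
      exact ⟨hf, m1, m2, m3, hx _ _ (fun l hl => (e l hl).symm) m4 h4⟩
    · rintro ⟨hf, -, -, -, h4⟩
      have m1 := hD _ hf k i
      have m2 := hD _ m1 i j
      have m3 := hD _ m2 j m
      have m4 := hD _ m3 m k
      exact ⟨hf, m1, m2, m3, hx _ _ e m4 h4⟩

theorem isSC (h : IsRep A V Φ) (hV : V.Nonempty) (hD : Diagonalizable V) (hP : Permutable V) :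
    A.IsSC := by
  -- The path from `f` to its swap goes through `f ∘ [i/j]`, first changing `i` and then `j`.
  have swap_mem : ∀ f ∈ V, ∀ i j : Fin n, ∀ y : A.carrier, f ∘ Equiv.swap i j ∈ Φ y →
      f ∈ Φ (A.c i (A.c j y)) := by
    intro f hf i j y hy
    refine h.mem_c.2 ⟨hf, f ∘ repl i j, h.mem_c.2 ⟨hD f hf i j, _, hy, fun l hl => ?_⟩,
      fun l hl => by simp [repl_apply, hl]⟩
    simp [repl_apply, Equiv.swap_apply_def, hl]
  have left_mem : ∀ f ∈ V, ∀ i j : Fin n, ∀ x : A.carrier, f ∈ Φ x →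
      f ∘ Equiv.swap i j ∈ Φ (A.s i j (A.c j x)) := by
    intro f hf i j x hx
    refine h.mem_s.2 ⟨hP f hf i j, h.mem_c.2 ⟨hD _ (hP f hf i j) i j, f, hx, fun l hl => ?_⟩⟩
    simp only [Function.comp_apply, repl_apply, Equiv.swap_apply_def]
    congr 1
    grind
  have right_mem : ∀ f ∈ V, ∀ i j : Fin n, ∀ x : A.carrier, f ∈ Φ x →
      f ∘ Equiv.swap i j ∈ Φ (A.s j i (A.c i x)) := by
    intro f hf i j x hx
    rw [Equiv.swap_comm]
    exact left_mem f hf j i x hx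
  refine { toIsDC := h.isDC hV hD, ax11 := ?_, ax12 := ?_ }
  · intro _ i j _ _ x
    refine h.le_iff.2 fun f hf => ?_
    rw [h.mem_mul, h.map_neg, Set.mem_sdiff, h.mem_d] at hf
    obtain ⟨hx, hfV, hd⟩ := hf
    refine swap_mem f hfV i j _ (h.mem_mul.2 ⟨h.mem_mul.2 ⟨?_, left_mem f hfV i j x hx⟩,
      right_mem f hfV i j x hx⟩)
    rw [h.map_neg, Set.mem_sdiff, h.mem_d]
    refine ⟨hP f hfV i j, fun e => hd ⟨hfV, ?_⟩⟩
    simpa using e.2.symm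
  · intro _ i j x
    refine h.le_iff.2 fun f hx => ?_
    have hfV := h.sub _ hx
    refine swap_mem f hfV i j _ (h.mem_mul.2 ⟨h.mem_mul.2 ⟨left_mem f hfV i j x hx,
      right_mem f hfV i j x hx⟩, h.mem_prod.2 ⟨hP f hfV i j, fun k hk => ?_⟩⟩)
    obtain ⟨hki, hkj⟩ := (Finset.mem_filter.1 hk).2
    have m0 := hP f hfV i j
    have m1 := hD _ m0 k i
    have m2 := hD _ m1 i j
    have m3 := hD _ m2 j k
    simp only [h.mem_s]
    refine ⟨m0, m1, m2, h.mem_c.2 ⟨m3, f, hx, fun l hl => ?_⟩⟩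
    simp only [Function.comp_apply, repl_apply, Equiv.swap_apply_def]
    congr 1
    grind

end IsRep

end CylAlg

/-! ### Frames and interchanges of coordinates -/

namespace CylAlg

variable {n : ℕ}

/-- `MerryWord E D i₀ w₀ τ w`: the world `w` is reached from `w₀` by free changes at places that
carry no `τ`-image of a place other than `i₀`, and by changes at `i` of a world in `D i j`, whereby
`τ` is followed by `[i/j]`. -/
inductive MerryWord {W : Type u} (E : Fin n → W → W → Prop) (D : Fin n → Fin n → W → Prop)
    (i₀ : Fin n) (w₀ : W) : (Fin n → Fin n) → W → Prop
  | nil : MerryWord E D i₀ w₀ id w₀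
  | free {τ : Fin n → Fin n} {w w' : W} {k : Fin n} : MerryWord E D i₀ w₀ τ w →
      (∀ l, l ≠ i₀ → τ l ≠ k) → E k w w' → MerryWord E D i₀ w₀ τ w'
  | subst {τ : Fin n → Fin n} {w u : W} {i j : Fin n} : MerryWord E D i₀ w₀ τ w → i ≠ j →
      D i j w → E i w u → MerryWord E D i₀ w₀ (repl i j ∘ τ) u

/-- The atom structures satisfying the first-order counterparts of axioms 1 to 7. -/
structure Frame (n : ℕ) (W : Type u) where
  E : Fin n → W → W → Prop
  D : Fin n → Fin n → W → Prop
  E_equiv : ∀ i, Equivalence (E i)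
  D_equiv : ∀ w, Equivalence fun i j => D i j w
  D_cyl : ∀ {i j k w w'}, k ≠ i → k ≠ j → E k w w' → D i j w → D i j w'
  sub_unique : ∀ {i j w w'}, i ≠ j → E i w w' → D i j w → D i j w' → w = w'
  merry : ∀ {i₀ w₀ τ w}, MerryWord E D i₀ w₀ τ w → (∀ l, l ≠ i₀ → D l (τ l) w) → E i₀ w₀ w

namespace Frame

variable {W : Type u} (F : Frame n W)

theorem D_cyl_iff {i j k : Fin n} {w w' : W} (hi : k ≠ i) (hj : k ≠ j) (h : F.E k w w') :
    F.D i j w ↔ F.D i j w' :=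
  ⟨F.D_cyl hi hj h, F.D_cyl hi hj ((F.E_equiv k).symm h)⟩

/-- `u` is the result of applying the substitution `[i/j]` to `w`. -/
def Sub (i j : Fin n) (w u : W) : Prop := F.E i w u ∧ F.D i j u

/-- No two distinct coordinates of `w` are identified. -/
def Distinct (w : W) : Prop := ∀ a b, F.D a b w → a = b

/-- `u` can serve as the result of interchanging the coordinates `i` and `j` of `w`. -/
structure IsSwap (i j : Fin n) (w u : W) : Prop where
  left : ∃ u', F.Sub i j u u' ∧ F.E j u' w
  right : ∃ u', F.Sub j i u u' ∧ F.E i u' w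
  other : ∀ k, k ≠ i → k ≠ j → ∃ u₁ u₂ u₃, F.Sub k i u u₁ ∧ F.Sub i j u₁ u₂ ∧ F.Sub j k u₂ u₃ ∧
    F.E k u₃ w

/-- `SwapReach w σ u`: `u` arises from `w` by interchanges whose composition is `σ`. -/
inductive SwapReach (w : W) : Equiv.Perm (Fin n) → W → Prop
  | refl : SwapReach w 1 w
  | tail {σ : Equiv.Perm (Fin n)} {u u' : W} {a b : Fin n} : SwapReach w σ u → a ≠ b →
      F.IsSwap a b u u' → F.Distinct u' → SwapReach w (σ * Equiv.swap a b) u'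

variable {F}

theorem SwapReach.distinct {w u : W} {σ : Equiv.Perm (Fin n)} (h : F.SwapReach w σ u)
    (hw : F.Distinct w) : F.Distinct u := by
  cases h with
  | refl => exact hw
  | tail _ _ _ h => exact h

/-! ### Following values along chains of changes -/

section Chains

variable {U : Type v}

/-- Equal terms of the sequence `f` are identified by `w`. -/
def Compat (F : Frame n W) (w : W) (f : Fin n → U) : Prop := ∀ i j, f i = f j → F.D i j w

theorem compat_of_injective (w : W) {f : Fin n → U} (hf : Function.Injective f) :
    F.Compat w f := by
  intro i j h
  rw [hf h]
  exact (F.D_equiv w).refl j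

theorem Compat.comp_repl {w w' : W} {f : Fin n → U} (h : F.Compat w f) {i j : Fin n} (hij : i ≠ j)
    (hs : F.Sub i j w w') : F.Compat w' (f ∘ repl i j) := by
  have key : ∀ b, b ≠ i → f j = f b → F.D i b w' := fun b hb e =>
    (F.D_equiv w').trans hs.2 (F.D_cyl hij hb.symm hs.1 (h _ _ e))
  intro a b hab
  simp only [Function.comp_apply, repl_apply] at hab
  by_cases ha : a = i <;> by_cases hb : b = i
  · rw [ha, hb]; exact (F.D_equiv w').refl i
  · rw [if_pos ha, if_neg hb] at hab
    rw [ha]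
    exact key b hb hab
  · rw [if_neg ha, if_pos hb] at hab
    rw [hb]
    exact (F.D_equiv w').symm (key a ha hab.symm)
  · rw [if_neg ha, if_neg hb] at hab
    exact F.D_cyl (Ne.symm ha) (Ne.symm hb) hs.1 (h _ _ hab)

/-- A change of the coordinate `e` of a labelled sequence that does not touch the values in `T`. -/
structure TEdge (F : Frame n W) (T : Set U) (e : Fin n) (a b : W × (Fin n → U)) : Prop where
  compat_left : F.Compat a.1 a.2
  compat_right : F.Compat b.1 b.2
  rel : F.E e a.1 b.1
  eqOff : EqOff e a.2 b.2
  keep : ∀ v ∈ T, ∃ l, l ≠ e ∧ a.2 l = v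

theorem TEdge.symm {T : Set U} {e : Fin n} {a b : W × (Fin n → U)} (h : F.TEdge T e a b) :
    F.TEdge T e b a where
  compat_left := h.compat_right
  compat_right := h.compat_left
  rel := (F.E_equiv e).symm h.rel
  eqOff l hl := (h.eqOff l hl).symm
  keep v hv := by
    obtain ⟨l, hl, e⟩ := h.keep v hv
    exact ⟨l, hl, by rw [← h.eqOff l hl, e]⟩

/-- Connection by a chain of changes that keep the values in `T`. -/
def Conn (F : Frame n W) (T : Set U) (a b : W × (Fin n → U)) : Prop :=
  Relation.ReflTransGen (fun a b => ∃ e, F.TEdge T e a b) a b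

theorem TEdge.conn {T : Set U} {e : Fin n} {a b : W × (Fin n → U)} (h : F.TEdge T e a b) :
    F.Conn T a b := Relation.ReflTransGen.single ⟨e, h⟩

theorem Conn.refl {T : Set U} (a : W × (Fin n → U)) : F.Conn T a a := Relation.ReflTransGen.refl

theorem Conn.trans {T : Set U} {a b c : W × (Fin n → U)} (h : F.Conn T a b) (h' : F.Conn T b c) :
    F.Conn T a c := Relation.ReflTransGen.trans h h'

theorem Conn.symm {T : Set U} {a b : W × (Fin n → U)} (h : F.Conn T a b) : F.Conn T b a :=
  have : Std.Symm fun a b => ∃ e, F.TEdge T e a b := ⟨fun _ _ ⟨e, h⟩ => ⟨e, h.symm⟩⟩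
  Relation.ReflTransGen.stdSymm.symm _ _ h

/-- Each value off `i₀` is followed by a token, `τ l` being its current place. A change at a place
without tokens is free; otherwise the value there also occurs elsewhere, by `keep`, and the token
moves to that copy. -/
theorem Conn.exists_merryWord {i₀ : Fin n} {a b : W × (Fin n → U)}
    (h : F.Conn (a.2 '' {i₀}ᶜ) a b) :
    ∃ τ, MerryWord F.E F.D i₀ a.1 τ b.1 ∧ ∀ l, l ≠ i₀ → b.2 (τ l) = a.2 l := by
  induction h with
  | refl => exact ⟨id, .nil, fun _ _ => rfl⟩
  | @tail b c _ hbc ih =>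
    obtain ⟨τ, hτ, hval⟩ := ih
    obtain ⟨e, hbc⟩ := hbc
    by_cases hfree : ∀ l, l ≠ i₀ → τ l ≠ e
    · exact ⟨τ, hτ.free hfree hbc.rel, fun l hl => by rw [← hbc.eqOff _ (hfree l hl), hval l hl]⟩
    · push Not at hfree
      obtain ⟨l₀, hl₀, rfl⟩ := hfree
      -- The copy at `e'` survives the change, and compatibility makes the current world identify
      -- the two places, as `MerryWord.subst` demands.
      obtain ⟨e', he', hv⟩ := hbc.keep (a.2 l₀) ⟨l₀, hl₀, rfl⟩
      rw [← hval l₀ hl₀] at hv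
      refine ⟨_, hτ.subst he'.symm (hbc.compat_left _ _ hv.symm) hbc.rel, fun l hl => ?_⟩
      simp only [Function.comp_apply, repl_apply]
      split_ifs with hle
      · rw [← hbc.eqOff _ he', hv, ← hle, hval l hl]
      · rw [← hbc.eqOff _ hle, hval l hl]

theorem Conn.rel_of_eqOff {i₀ : Fin n} {a b : W × (Fin n → U)}
    (h : F.Conn (a.2 '' {i₀}ᶜ) a b) (hb : F.Compat b.1 b.2) (hab : EqOff i₀ a.2 b.2) :
    F.E i₀ a.1 b.1 := by
  obtain ⟨τ, hτ, hval⟩ := h.exists_merryWord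
  exact F.merry hτ fun l hl => hb _ _ (by rw [hval l hl, hab l hl])

theorem TEdge.of_sub {T : Set U} {i j : Fin n} (hij : i ≠ j) {w w' : W} {f : Fin n → U}
    (hs : F.Sub i j w w') (hf : F.Compat w f) (hT : ∀ v ∈ T, ∃ l, l ≠ i ∧ f l = v) :
    F.TEdge T i (w, f) (w', f ∘ repl i j) where
  compat_left := hf
  compat_right := hf.comp_repl hij hs
  rel := hs.1
  eqOff l hl := by simp [repl_apply, hl]
  keep := hT

/-- Read from the swapped sequence: copying the value at `j` onto `i` loses `f j`, which is harmless
since `T` is realized off `j`; rewriting `j` then restores `f`. -/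
theorem conn_swap_aux {T : Set U} {i j : Fin n} (hij : i ≠ j) {w u u' : W} {f : Fin n → U}
    (hf : Function.Injective f) (hT : ∀ v ∈ T, ∃ l, l ≠ j ∧ f l = v) (hs : F.Sub i j u u')
    (hE : F.E j u' w) : F.Conn T (w, f) (u, f ∘ Equiv.swap i j) := by
  have hc := compat_of_injective (F := F) u (hf.comp (Equiv.swap i j).injective)
  refine Conn.symm ((TEdge.of_sub hij hs hc ?_).conn.trans (TEdge.conn (e := j)
    ⟨hc.comp_repl hij hs, compat_of_injective w hf, hE, ?_, ?_⟩))
  · intro v hv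
    obtain ⟨l, hl, rfl⟩ := hT v hv
    refine ⟨Equiv.swap i j l, fun e => hl ?_, by simp⟩
    rw [← Equiv.swap_apply_left i j] at e
    exact (Equiv.swap i j).injective (by simpa using e)
  · intro l hl
    simp only [Function.comp_apply, repl_apply, Equiv.swap_apply_def]
    congr 1
    grind
  · intro v hv
    obtain ⟨l, hl, rfl⟩ := hT v hv
    refine ⟨l, hl, ?_⟩
    simp only [Function.comp_apply, repl_apply, Equiv.swap_apply_def]
    congr 1
    grind

/-- The three parts of `IsSwap` answer the three positions of the dispensable place `k`: `right` for
`k = i`, `left` for `k = j`, and `other` when `k` must serve as scratch place for the interchange.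
In each case only `f k` is lost on the way. -/
theorem IsSwap.conn {T : Set U} {i j : Fin n} (hij : i ≠ j) {w u : W} (h : F.IsSwap i j w u)
    {f : Fin n → U} (hf : Function.Injective f) (hT : T ⊆ Set.range f) {k : Fin n} (hk : f k ∉ T) :
    F.Conn T (w, f) (u, f ∘ Equiv.swap i j) := by
  have hT' : ∀ v ∈ T, ∃ l, l ≠ k ∧ f l = v := by
    intro v hv
    obtain ⟨l, rfl⟩ := hT hv
    exact ⟨l, fun e => hk (e ▸ hv), rfl⟩
  by_cases hki : k = i
  · subst hki
    obtain ⟨u', hs, hE⟩ := h.right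
    rw [Equiv.swap_comm]
    exact conn_swap_aux hij.symm hf hT' hs hE
  by_cases hkj : k = j
  · subst hkj
    obtain ⟨u', hs, hE⟩ := h.left
    exact conn_swap_aux hij hf hT' hs hE
  obtain ⟨u₁, u₂, u₃, h₁, h₂, h₃, hE⟩ := h.other k hki hkj
  have c₀ := compat_of_injective (F := F) u (hf.comp (Equiv.swap i j).injective)
  have c₁ := c₀.comp_repl hki h₁
  have c₂ := c₁.comp_repl hij h₂
  have c₃ := c₂.comp_repl (Ne.symm hkj) h₃
  refine Conn.symm ((TEdge.of_sub hki h₁ c₀ ?_).conn.trans ((TEdge.of_sub hij h₂ c₁ ?_).conn.trans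
    ((TEdge.of_sub (Ne.symm hkj) h₃ c₂ ?_).conn.trans (TEdge.conn (e := k)
    ⟨c₃, compat_of_injective w hf, hE, ?_, ?_⟩))))
  · intro v hv
    obtain ⟨l, hl, rfl⟩ := hT' v hv
    refine ⟨Equiv.swap i j l, ?_, by simp⟩
    rw [Equiv.swap_apply_def]
    grind
  · intro v hv
    obtain ⟨l, hl, rfl⟩ := hT' v hv
    refine ⟨if l = j then k else if l = i then j else l, by grind, ?_⟩
    simp only [Function.comp_apply, repl_apply, Equiv.swap_apply_def]
    congr 1
    grind
  · intro v hv
    obtain ⟨l, hl, rfl⟩ := hT' v hv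
    refine ⟨if l = j then k else l, by grind, ?_⟩
    simp only [Function.comp_apply, repl_apply, Equiv.swap_apply_def]
    congr 1
    grind
  · intro l hl
    simp only [Function.comp_apply, repl_apply, Equiv.swap_apply_def]
    congr 1
    grind
  · intro v hv
    obtain ⟨l, hl, rfl⟩ := hT' v hv
    refine ⟨l, hl, ?_⟩
    simp only [Function.comp_apply, repl_apply, Equiv.swap_apply_def]
    congr 1
    grind

theorem SwapReach.conn {T : Set U} {w u : W} {σ : Equiv.Perm (Fin n)} (h : F.SwapReach w σ u)
    {f : Fin n → U} (hf : Function.Injective f) (hT : T ⊆ Set.range f) {k : Fin n} (hk : f k ∉ T) :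
    F.Conn T (w, f) (u, f ∘ σ) := by
  induction h with
  | refl => exact Conn.refl _
  | @tail σ u u' a b _ hab hs _ ih =>
    refine ih.trans ?_
    rw [Equiv.Perm.coe_mul, ← Function.comp_assoc]
    refine hs.conn hab (hf.comp σ.injective) (k := σ.symm k) ?_ (by simpa using hk)
    rw [σ.surjective.range_comp]
    exact hT

/-- Pigeonhole: `n` distinct values do not fit among at most `n - 1`. -/
theorem exists_notMem_image {i₀ : Fin n} (g : Fin n → U) {f : Fin n → U}
    (hf : Function.Injective f) : ∃ k, f k ∉ g '' {i₀}ᶜ := by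
  by_contra! h
  choose l hl e using h
  have hinj : Function.Injective l := fun a b hab => hf (by rw [← e a, ← e b, hab])
  obtain ⟨a, ha⟩ := Finite.surjective_of_injective hinj i₀
  exact hl a ha

end Chains

end Frame

end CylAlg

/-! ### Unravelling a frame into sequences -/

namespace CylAlg

variable {n : ℕ}

namespace Frame

variable {W : Type u}

/-- The set `V` of sequences, labelled by worlds, represents the frame `F`. -/
structure IsUnravelling (F : Frame n W) {U : Type v} (V : Set (Fin n → U))
    (lab : (Fin n → U) → W) : Prop where
  surj : ∀ w, ∃ f ∈ V, lab f = w
  diag : ∀ f ∈ V, ∀ i j, f i = f j ↔ F.D i j (lab f)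
  forth : ∀ f ∈ V, ∀ g ∈ V, ∀ i, EqOff i f g → F.E i (lab f) (lab g)
  back : ∀ f ∈ V, ∀ i w, F.E i (lab f) w → ∃ g ∈ V, EqOff i f g ∧ lab g = w

/-- The sequence that `back` yields for the substituted world has equal terms at `i` and `j`, hence
is `f ∘ [i/j]` itself. -/
theorem IsUnravelling.diagonalizable {F : Frame n W} {U : Type v} {V : Set (Fin n → U)}
    {lab : (Fin n → U) → W} (h : F.IsUnravelling V lab)
    (hF : ∀ i j, i ≠ j → ∀ w, ∃ w', F.Sub i j w w') : Diagonalizable V := by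
  intro f hf i j
  by_cases hij : i = j
  · rw [hij, repl_self]
    exact hf
  obtain ⟨w, hE, hD⟩ := hF i j hij (lab f)
  obtain ⟨g, hg, e, rfl⟩ := h.back f hf i w hE
  convert hg
  funext l
  simp only [Function.comp_apply, repl_apply]
  split_ifs with hl
  · rw [hl, (h.diag g hg i j).2 hD, e j (Ne.symm hij)]
  · exact e l hl

/-- A repeated value leaves one place free as scratch space, so the swap is a composition of
replacements. -/
theorem _root_.CylAlg.Diagonalizable.comp_swap_mem {U : Type v} {V : Set (Fin n → U)}
    (hV : Diagonalizable V) {f : Fin n → U} (hf : f ∈ V) (hinj : ¬ Function.Injective f)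
    (i j : Fin n) : f ∘ Equiv.swap i j ∈ V := by
  have key : ∀ i j b : Fin n, b ≠ i → b ≠ j → f i = f b → f ∘ Equiv.swap i j ∈ V := by
    intro i j b hi hj e
    convert hV _ (hV _ hf i j) j b using 1
    funext l
    simp only [Function.comp_apply, repl_apply, Equiv.swap_apply_def]
    grind
  obtain ⟨a, b, hab, hne⟩ := Function.not_injective_iff.1 hinj
  by_cases hai : a = i
  · subst hai
    by_cases hbj : b = j
    · subst hbj
      convert hf using 1
      funext l
      simp only [Function.comp_apply, Equiv.swap_apply_def]
      grind
    · exact key a j b hne.symm hbj hab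
  by_cases haj : a = j
  · subst haj
    by_cases hbi : b = i
    · subst hbi
      convert hf using 1
      funext l
      simp only [Function.comp_apply, Equiv.swap_apply_def]
      grind
    · rw [Equiv.swap_comm]
      exact key a i b hne.symm hbi hab
  by_cases hbi : b = i
  · subst hbi
    exact key b j a hne haj hab.symm
  by_cases hbj : b = j
  · subst hbj
    rw [Equiv.swap_comm]
    exact key b i a hne hai hab.symm
  -- Here `a` is the scratch place, and its value is finally recovered from `b`.
  convert hV _ (hV _ (hV _ (hV _ hf a i) i j) j a) a b using 1
  funext l
  simp only [Function.comp_apply, repl_apply, Equiv.swap_apply_def]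
  grind

/-- Nodes of the unravelling tree. The node `step p σ i w` arises from the sequence of `p`,
rearranged by `σ`, by a change at the place `i`; its label is `w`. -/
inductive Node (n : ℕ) (W : Type u) : Type (max u v)
  | root (w : W) : Node n W
  | step (p : Node n W) (σ : Equiv.Perm (Fin n)) (i : Fin n) (w : W) : Node n W

namespace Node

def label : Node.{u, v} n W → W
  | root w => w
  | step _ _ _ w => w

def height : Node.{u, v} n W → ℕ
  | root _ => 0
  | step p _ _ _ => p.height + 1

variable (F : Frame n W) (perm : Prop) (act : W → Equiv.Perm (Fin n) → W)

/-- A representative of the set of coordinates that `w` identifies with `i`. -/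
noncomputable def rep (w : W) (i : Fin n) : Fin n :=
  (Quotient.mk ⟨fun i j => F.D i j w, F.D_equiv w⟩ i).out

theorem rep_eq_rep_iff {w : W} {i j : Fin n} : rep F w i = rep F w j ↔ F.D i j w := by
  rw [rep, rep, Quotient.out_inj, Quotient.eq]
  rfl

open Classical in
/-- The sequence of a node. Its terms are tagged by the node and the place of their creation. -/
noncomputable def seq : Node.{u, v} n W → Fin n → Node.{u, v} n W × Fin n
  | root w => fun i => (root w, rep F w i)
  | step p σ i w => Function.update (seq p ∘ σ) i
      (if h : ∃ j, j ≠ i ∧ F.D i j w then (seq p ∘ σ) h.choose else (step p σ i w, i))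

/-- The rearrangement by `σ` may be applied to the world `w`. -/
def Admissible (w : W) (σ : Equiv.Perm (Fin n)) : Prop := σ = 1 ∨ perm ∧ F.Distinct w

def Valid : Node.{u, v} n W → Prop
  | root _ => True
  | step p σ i w => p.Valid ∧ Admissible F perm p.label σ ∧ F.E i (act p.label σ) w

variable {F perm act}

/-- Terms are inherited from the parent or tagged by the node itself, so a foreign tag belongs to a
strictly lower node. -/
theorem height_lt_or_eq_of_seq_eq {p r : Node.{u, v} n W} {a c : Fin n}
    (h : seq F p a = (r, c)) : r.height < p.height ∨ r = p := by
  induction p generalizing a with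
  | root w => exact .inr (congrArg Prod.fst h).symm
  | step p σ i w ih =>
    have old : ∀ b, seq F p b = (r, c) → r.height < (step p σ i w).height := by
      intro b hb
      rcases ih hb with h | h
      · simp only [height]; omega
      · simp [height, h]
    simp only [seq, Function.update_apply] at h
    split_ifs at h with h1 h2
    · exact .inl (old _ h)
    · exact .inr (congrArg Prod.fst h).symm
    · exact .inl (old _ h)

theorem seq_ne_fresh {p q : Node.{u, v} n W} (h : q.height ≤ p.height) (hne : p ≠ q) (a c : Fin n) :
    seq F q a ≠ (p, c) := by
  intro e
  rcases height_lt_or_eq_of_seq_eq e with h' | h'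
  · omega
  · exact hne h'

theorem seq_step_ne_fresh {p : Node.{u, v} n W} {σ : Equiv.Perm (Fin n)} {i : Fin n} {w : W}
    (a c : Fin n) : seq F p a ≠ (step p σ i w, c) := by
  refine seq_ne_fresh (by simp [height]) (fun e => ?_) a c
  have := congrArg height e
  simp [height] at this

theorem seq_step_of_ne {p : Node.{u, v} n W} {σ : Equiv.Perm (Fin n)} {i : Fin n} {w : W}
    {l : Fin n} (hl : l ≠ i) : seq F (step p σ i w) l = seq F p (σ l) := by
  simp [seq, hl]

theorem seq_step_self {p : Node.{u, v} n W} {σ : Equiv.Perm (Fin n)} {i : Fin n} {w : W} :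
    (∃ j, j ≠ i ∧ F.D i j w ∧ seq F (step p σ i w) i = seq F p (σ j)) ∨
    (∀ j, j ≠ i → ¬ F.D i j w) ∧ seq F (step p σ i w) i = (step p σ i w, i) := by
  by_cases h : ∃ j, j ≠ i ∧ F.D i j w
  · exact .inl ⟨h.choose, h.choose_spec.1, h.choose_spec.2, by simp [seq, h]⟩
  · refine .inr ⟨fun j hj hD => h ⟨j, hj, hD⟩, ?_⟩
    simp only [seq, h, Function.update_self, dite_false]

/-- The choice of a rearranged world for every admissible rearrangement. -/
structure IsAction (F : Frame n W) (perm : Prop) (act : W → Equiv.Perm (Fin n) → W) : Prop where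
  one : ∀ w, act w 1 = w
  reach : perm → ∀ w σ, F.Distinct w → F.SwapReach w σ (act w σ)

theorem seq_comp_eq_iff_of_seq_eq_iff (hact : IsAction F perm act) {p : Node.{u, v} n W}
    (hp : ∀ a b, seq F p a = seq F p b ↔ F.D a b p.label) {σ : Equiv.Perm (Fin n)}
    (hσ : Admissible F perm p.label σ) (a b : Fin n) :
    seq F p (σ a) = seq F p (σ b) ↔ F.D a b (act p.label σ) := by
  rcases hσ with rfl | ⟨hperm, hd⟩
  · rw [hact.one]
    exact hp a b
  · rw [hp]
    constructor
    · intro h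
      rw [σ.injective (hd _ _ h)]
      exact (F.D_equiv _).refl b
    · intro h
      rw [(hact.reach hperm _ σ hd).distinct hd _ _ h]
      exact (F.D_equiv _).refl _

theorem seq_eq_iff (hact : IsAction F perm act) {p : Node.{u, v} n W} (hp : p.Valid F perm act)
    (a b : Fin n) : seq F p a = seq F p b ↔ F.D a b p.label := by
  induction p generalizing a b with
  | root w => simp [seq, label, rep_eq_rep_iff]
  | step p σ i w ih =>
    obtain ⟨hp, hσ, hE⟩ := hp
    have old := seq_comp_eq_iff_of_seq_eq_iff hact (ih hp) hσ
    have key : ∀ b, b ≠ i → (seq F (step p σ i w) i = seq F (step p σ i w) b ↔ F.D i b w) := by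
      intro b hb
      rw [seq_step_of_ne hb]
      rcases seq_step_self (F := F) (p := p) (σ := σ) (i := i) (w := w) with
        ⟨j, hj, hD, e⟩ | ⟨hD, e⟩
      · rw [e, old, F.D_cyl_iff hj.symm hb.symm hE]
        exact ⟨(F.D_equiv w).trans hD, (F.D_equiv w).trans ((F.D_equiv w).symm hD)⟩
      · rw [e]
        exact ⟨fun h => (seq_step_ne_fresh _ _ h.symm).elim, fun h => (hD b hb h).elim⟩
    by_cases ha : a = i <;> by_cases hb : b = i
    · rw [ha, hb]
      exact ⟨fun _ => (F.D_equiv _).refl i, fun _ => rfl⟩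
    · rw [ha]
      exact key b hb
    · rw [hb, eq_comm, key a ha]
      exact ⟨(F.D_equiv w).symm, (F.D_equiv w).symm⟩
    · rw [seq_step_of_ne ha, seq_step_of_ne hb, old]
      exact F.D_cyl_iff (Ne.symm ha) (Ne.symm hb) hE

theorem seq_comp_eq_iff (hact : IsAction F perm act) {p : Node.{u, v} n W}
    (hp : p.Valid F perm act) {σ : Equiv.Perm (Fin n)} (hσ : Admissible F perm p.label σ)
    (a b : Fin n) : seq F p (σ a) = seq F p (σ b) ↔ F.D a b (act p.label σ) :=
  seq_comp_eq_iff_of_seq_eq_iff hact (seq_eq_iff hact hp) hσ a b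

theorem conn_comp (hact : IsAction F perm act) {T : Set (Node.{u, v} n W × Fin n)}
    (hsmall : ∀ f : Fin n → Node.{u, v} n W × Fin n, Function.Injective f → ∃ k, f k ∉ T)
    {p : Node.{u, v} n W} (hp : p.Valid F perm act) {σ : Equiv.Perm (Fin n)}
    (hσ : Admissible F perm p.label σ) (hT : T ⊆ Set.range (seq F p)) :
    F.Conn T (p.label, seq F p) (act p.label σ, seq F p ∘ σ) := by
  rcases hσ with rfl | ⟨hperm, hd⟩
  · rw [hact.one]
    exact Conn.refl _
  · have hinj : Function.Injective (seq F p) := fun a b h => hd _ _ ((seq_eq_iff hact hp a b).1 h)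
    obtain ⟨k, hk⟩ := hsmall _ hinj
    exact (hact.reach hperm _ σ hd).conn hinj hT hk

/-- Induction on the sum of heights, stepping from the higher node to its parent. The tag of the
higher node is absent from the other sequence, so the value placed at `i` is either outside `T` or a
copy of another term; hence the step keeps `T`. -/
theorem conn_of_subset_range (hact : IsAction F perm act) {T : Set (Node.{u, v} n W × Fin n)}
    (hne : T.Nonempty)
    (hsmall : ∀ f : Fin n → Node.{u, v} n W × Fin n, Function.Injective f → ∃ k, f k ∉ T)
    {p q : Node.{u, v} n W} (hp : p.Valid F perm act) (hq : q.Valid F perm act)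
    (hTp : T ⊆ Set.range (seq F p)) (hTq : T ⊆ Set.range (seq F q)) :
    F.Conn T (p.label, seq F p) (q.label, seq F q) := by
  induction hN : p.height + q.height using Nat.strong_induction_on generalizing p q with
  | _ N ih =>
  subst hN
  wlog hle : q.height ≤ p.height generalizing p q
  · refine (this hq hp hTq hTp (fun m hm p q hp hq h1 h2 h3 => ih m ?_ hp hq h1 h2 h3)
      (by omega)).symm
    omega
  by_cases hpq : p = q
  · rw [hpq]
    exact Conn.refl _
  obtain ⟨v, hv⟩ := hne
  cases p with
  | root w =>
    cases q with
    | root w' =>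
      -- Distinct roots share no terms; this is where `T` must be nonempty.
      obtain ⟨a, ha⟩ := hTp hv
      obtain ⟨b, hb⟩ := hTq hv
      exact (hpq (congrArg Prod.fst (ha.trans hb.symm))).elim
    | step q σ i w' => simp [height] at hle
  | step p σ i w =>
    have hfresh : ∀ c, (step p σ i w, c) ∉ T := fun c hc => by
      obtain ⟨a, ha⟩ := hTq hc
      exact seq_ne_fresh hle hpq a c ha
    have hkeep : ∀ v ∈ T, ∃ l, l ≠ i ∧ (seq F p ∘ σ) l = v := by
      intro v hv
      obtain ⟨l, rfl⟩ := hTp hv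
      by_cases hl : l = i
      · subst hl
        rcases seq_step_self (F := F) (p := p) (σ := σ) (i := l) (w := w) with
          ⟨j, hj, -, e⟩ | ⟨-, e⟩
        · exact ⟨j, hj, e.symm⟩
        · rw [e] at hv
          exact (hfresh _ hv).elim
      · exact ⟨l, hl, (seq_step_of_ne hl).symm⟩
    have hTp' : T ⊆ Set.range (seq F p) := fun v hv => by
      obtain ⟨l, -, e⟩ := hkeep v hv
      exact ⟨_, e⟩
    have hpv := hp
    obtain ⟨hp, hσ, hE⟩ := hp
    refine Conn.trans (Conn.symm ?_) (ih _ ?_ hp hq hTp' hTq rfl)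
    · refine (conn_comp hact hsmall hp hσ hTp').trans (TEdge.conn (e := i)
        ⟨fun a b => (seq_comp_eq_iff hact hp hσ a b).1, fun a b => (seq_eq_iff hact hpv a b).1, hE,
          fun l hl => (seq_step_of_ne hl).symm, hkeep⟩)
    · simp only [height]; omega

theorem rel_of_eqOff (hn : 2 ≤ n) (hact : IsAction F perm act) {p q : Node.{u, v} n W}
    (hp : p.Valid F perm act) (hq : q.Valid F perm act) {σ ρ : Equiv.Perm (Fin n)}
    (hσ : Admissible F perm p.label σ) (hρ : Admissible F perm q.label ρ) {i : Fin n}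
    (h : EqOff i (seq F p ∘ σ) (seq F q ∘ ρ)) :
    F.E i (act p.label σ) (act q.label ρ) := by
  have hsmall := fun f hf => exists_notMem_image (i₀ := i) (seq F p ∘ σ) (f := f) hf
  have hne : ((seq F p ∘ σ) '' {i}ᶜ).Nonempty := by
    have : Nontrivial (Fin n) := Fin.nontrivial_iff_two_le.2 hn
    obtain ⟨l, hl⟩ := exists_ne i
    exact ⟨_, l, hl, rfl⟩
  have hTp : (seq F p ∘ σ) '' {i}ᶜ ⊆ Set.range (seq F p) := by
    rintro _ ⟨l, -, rfl⟩
    exact ⟨σ l, rfl⟩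
  have hTq : (seq F p ∘ σ) '' {i}ᶜ ⊆ Set.range (seq F q) := by
    rintro _ ⟨l, hl, rfl⟩
    exact ⟨ρ l, (h l hl).symm⟩
  exact Conn.rel_of_eqOff (a := (act p.label σ, seq F p ∘ σ)) (b := (act q.label ρ, seq F q ∘ ρ))
    ((conn_comp hact hsmall hp hσ hTp).symm.trans
      ((conn_of_subset_range hact hne hsmall hp hq hTp hTq).trans
        (conn_comp hact hsmall hq hρ hTq)))
    (fun a b => (seq_comp_eq_iff hact hq hρ a b).1) h

/-- An injective sequence contains a term tagged by its own node, which cannot occur at a different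
node that is not higher. -/
theorem eq_of_range_eq (hn : 2 ≤ n) {p q : Node.{u, v} n W}
    (hpi : Function.Injective (seq F p)) (hqi : Function.Injective (seq F q))
    (h : Set.range (seq F p) = Set.range (seq F q)) : p = q := by
  wlog hle : q.height ≤ p.height generalizing p q
  · exact (this hqi hpi h.symm (by omega)).symm
  by_contra hpq
  have hfresh : ∀ a c, seq F p a ≠ (p, c) := by
    intro a c e
    obtain ⟨b, hb⟩ : seq F p a ∈ Set.range (seq F q) := h ▸ ⟨a, rfl⟩
    exact seq_ne_fresh hle hpq b c (hb.trans e)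
  cases p with
  | root w => exact hfresh ⟨0, by omega⟩ _ rfl
  | step p σ i w =>
    rcases seq_step_self (F := F) (p := p) (σ := σ) (i := i) (w := w) with
      ⟨j, hj, -, e⟩ | ⟨-, e⟩
    · rw [← seq_step_of_ne (w := w) hj] at e
      exact hj (hpi e).symm
    · exact hfresh _ _ e

/-- This makes the label a function of the sequence. An injective sequence determines node and
rearrangement; if the places `a ≠ b` carry equal terms, both labels lie in `D a b` and are `E
a`-related, hence equal. -/
theorem label_eq_of_seq_eq (hn : 2 ≤ n) (hact : IsAction F perm act) {p q : Node.{u, v} n W}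
    (hp : p.Valid F perm act) (hq : q.Valid F perm act) {σ ρ : Equiv.Perm (Fin n)}
    (hσ : Admissible F perm p.label σ) (hρ : Admissible F perm q.label ρ)
    (h : seq F p ∘ σ = seq F q ∘ ρ) : act p.label σ = act q.label ρ := by
  by_cases hinj : Function.Injective (seq F p ∘ σ)
  · have hpi : Function.Injective (seq F p) := (σ.injective_comp _).1 hinj
    have hqi : Function.Injective (seq F q) := (ρ.injective_comp _).1 (h ▸ hinj)
    have hpq : p = q := eq_of_range_eq hn hpi hqi (by
      rw [← σ.surjective.range_comp, h, ρ.surjective.range_comp])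
    subst hpq
    have : σ = ρ := Equiv.ext fun l => hpi (congrFun h l)
    rw [this]
  · obtain ⟨a, b, hab, hne⟩ := Function.not_injective_iff.1 hinj
    have hab' : (seq F q ∘ ρ) a = (seq F q ∘ ρ) b := h ▸ hab
    exact F.sub_unique hne (rel_of_eqOff hn hact hp hq hσ hρ fun l _ => congrFun h l)
      ((seq_comp_eq_iff hact hp hσ a b).1 hab) ((seq_comp_eq_iff hact hq hρ a b).1 hab')

variable (F perm act) in
/-- The sequences of the valid nodes and their admissible rearrangements. -/
def seqs : Set (Fin n → Node.{u, v} n W × Fin n) :=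
  {f | ∃ (p : Node.{u, v} n W) (σ : Equiv.Perm (Fin n)), p.Valid F perm act ∧
    Admissible F perm p.label σ ∧ seq F p ∘ σ = f}

theorem exists_isUnravelling_seqs [Inhabited W] (hn : 2 ≤ n) (hact : IsAction F perm act) :
    ∃ lab, F.IsUnravelling (seqs.{u, v} F perm act) lab := by
  classical
  let lab : (Fin n → Node.{u, v} n W × Fin n) → W := fun f =>
    if h : f ∈ seqs.{u, v} F perm act then act h.choose.label h.choose_spec.choose else default
  have hlab : ∀ (p : Node.{u, v} n W) (σ : Equiv.Perm (Fin n)), p.Valid F perm act →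
      Admissible F perm p.label σ → lab (seq F p ∘ σ) = act p.label σ := by
    intro p σ hp hσ
    have h : seq F p ∘ σ ∈ seqs.{u, v} F perm act := ⟨p, σ, hp, hσ, rfl⟩
    obtain ⟨h1, h2, h3⟩ := h.choose_spec.choose_spec
    simp only [lab, h, dite_true]
    exact label_eq_of_seq_eq hn hact h1 hp h2 hσ h3
  refine ⟨lab, ?_, ?_, ?_, ?_⟩
  · exact fun w => ⟨_, ⟨root w, 1, trivial, .inl rfl, rfl⟩,
      (hlab (root w) 1 trivial (.inl rfl)).trans (hact.one w)⟩
  · rintro _ ⟨p, σ, hp, hσ, rfl⟩ i j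
    rw [hlab p σ hp hσ]
    exact seq_comp_eq_iff hact hp hσ i j
  · rintro _ ⟨p, σ, hp, hσ, rfl⟩ _ ⟨q, ρ, hq, hρ, rfl⟩ i h
    rw [hlab p σ hp hσ, hlab q ρ hq hρ]
    exact rel_of_eqOff hn hact hp hq hσ hρ h
  · rintro _ ⟨p, σ, hp, hσ, rfl⟩ i w h
    rw [hlab p σ hp hσ] at h
    have hv : (step p σ i w).Valid F perm act := ⟨hp, hσ, h⟩
    exact ⟨_, ⟨step p σ i w, 1, hv, .inl rfl, rfl⟩, fun l hl => (seq_step_of_ne hl).symm,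
      (hlab (step p σ i w) 1 hv (.inl rfl)).trans (hact.one w)⟩

theorem permutable_seqs (hact : IsAction F perm act) (hperm : perm)
    (hD : Diagonalizable (seqs.{u, v} F perm act)) : Permutable (seqs.{u, v} F perm act) := by
  intro f hf i j
  by_cases hinj : Function.Injective f
  · obtain ⟨p, σ, hp, hσ, rfl⟩ := hf
    have hpi : Function.Injective (seq F p) := (σ.injective_comp _).1 hinj
    exact ⟨p, σ * Equiv.swap i j, hp,
      .inr ⟨hperm, fun a b h => hpi ((seq_eq_iff hact hp a b).2 h)⟩, rfl⟩
  · exact hD.comp_swap_mem hf hinj i j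

end Node

theorem exists_isUnravelling [Inhabited W] (F : Frame n W) (hn : 2 ≤ n) :
    ∃ (U : Type max u v) (V : Set (Fin n → U)) (lab : (Fin n → U) → W), F.IsUnravelling V lab := by
  -- With `False`, only the identity rearrangement is admissible.
  have hact : Node.IsAction F False fun w _ => w := ⟨fun _ => rfl, False.elim⟩
  obtain ⟨lab, h⟩ := Node.exists_isUnravelling_seqs.{u, v} hn hact
  exact ⟨_, _, lab, h⟩

theorem exists_isUnravelling_permutable [Inhabited W] (F : Frame n W) (hn : 2 ≤ n)
    (hF : ∀ i j, i ≠ j → ∀ w, ∃ w', F.Sub i j w w')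
    (hF' : ∀ i j, i ≠ j → ∀ w, F.Distinct w → ∃ u, F.Distinct u ∧ F.IsSwap i j w u) :
    ∃ (U : Type max u v) (V : Set (Fin n → U)) (lab : (Fin n → U) → W), F.IsUnravelling V lab ∧
      Permutable V := by
  classical
  have hreach : ∀ w σ, F.Distinct w → ∃ u, F.SwapReach w σ u := by
    intro w σ hw
    refine Equiv.Perm.swap_induction_on' (motive := fun σ => ∃ u, F.SwapReach w σ u) σ
      ⟨w, .refl⟩ ?_
    rintro σ a b hab ⟨u, hu⟩
    obtain ⟨u', hd, hs⟩ := hF' a b hab u (hu.distinct hw)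
    exact ⟨u', hu.tail hab hs hd⟩
  choose! r hr using hreach
  -- The identity is treated apart because swaps composing to `1` might lead to a world other than
  -- `w`.
  have hact : Node.IsAction F True fun w σ => if σ = 1 then w else r w σ := by
    refine ⟨fun w => if_pos rfl, fun _ w σ hw => ?_⟩
    split_ifs with h
    · rw [h]
      exact .refl
    · exact hr w σ hw
  obtain ⟨lab, h⟩ := Node.exists_isUnravelling_seqs.{u, v} hn hact
  exact ⟨_, _, lab, h, Node.permutable_seqs hact trivial (h.diagonalizable hF)⟩

end Frame

end CylAlg

/-! ### The ultrafilter frame of an algebra -/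

theorem replComp_congr {n : ℕ} {i j i' j' : ℕ → Fin n} :
    ∀ {m : ℕ}, (∀ t < m, i t = i' t ∧ j t = j' t) → replComp i j m = replComp i' j' m := by
  intro m
  induction m with
  | zero => exact fun _ => rfl
  | succ m ih =>
    intro h
    rw [replComp, replComp, ih fun t ht => h t (by omega), (h m (by omega)).1, (h m (by omega)).2]

namespace CylAlg

variable {n : ℕ}

theorem word_congr (A : CylAlg.{u} n) {i j k i' j' k' : ℕ → Fin n} {x : A.carrier} :
    ∀ {m : ℕ}, (∀ t < m, i t = i' t ∧ j t = j' t ∧ k t = k' t) →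
      A.word i j k x m = A.word i' j' k' x m := by
  intro m
  induction m with
  | zero => exact fun _ => rfl
  | succ m ih =>
    intro h
    obtain ⟨h1, h2, h3⟩ := h m (by omega)
    rw [word, word, ih fun t ht => h t (by omega), h1, h2, h3]

/-- Ultrafilters of the Boolean reduct. -/
@[ext]
structure UF (A : CylAlg.{u} n) : Type u where
  set : Set A.carrier
  one_mem : A.one ∈ set
  mul_mem : ∀ {x y}, A.mul x y ∈ set ↔ x ∈ set ∧ y ∈ set
  neg_mem : ∀ {x}, A.neg x ∈ set ↔ x ∉ set

namespace UF

variable {A : CylAlg.{u} n}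

theorem mono (w : UF A) {x y : A.carrier} (h : A.le x y) (hx : x ∈ w.set) : y ∈ w.set := by
  rw [CylAlg.le] at h
  rw [← h] at hx
  exact (w.mul_mem.1 hx).2

theorem mem_prod (w : UF A) {K : Finset (Fin n)} {f : Fin n → A.carrier} :
    A.prod K f ∈ w.set ↔ ∀ l ∈ K, f l ∈ w.set := by
  have key : ∀ L : List A.carrier, L.foldr A.mul A.one ∈ w.set ↔ ∀ x ∈ L, x ∈ w.set := by
    intro L
    induction L with
    | nil => simp [w.one_mem]
    | cons a L ih => simp [w.mul_mem, ih]
  simp [CylAlg.prod, key]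

theorem exists_of_directed (hA : A.IsBoolean) {S : Set A.carrier} (hne : S.Nonempty)
    (hdir : ∀ x ∈ S, ∀ y ∈ S, ∃ z ∈ S, A.le z (A.mul x y)) (h0 : A.zero ∉ S) :
    ∃ w : UF A, S ⊆ w.set := by
  obtain ⟨-, inst, -, hmul, hneg, hzero, hone⟩ := hA
  simp only [CylAlg.le, hmul, inf_eq_left] at hdir
  rw [hzero] at h0
  obtain ⟨x₀, hx₀⟩ := hne
  have hF : Order.IsPFilter {y : A.carrier | ∃ x ∈ S, x ≤ y} := by
    refine Order.IsPFilter.of_def ⟨x₀, x₀, hx₀, le_rfl⟩ ?_ ?_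
    · rintro y ⟨x, hx, hxy⟩ y' ⟨x', hx', hxy'⟩
      obtain ⟨z, hz, hle⟩ := hdir x hx x' hx'
      exact ⟨z, ⟨z, hz, le_rfl⟩, (hle.trans inf_le_left).trans hxy,
        (hle.trans inf_le_right).trans hxy'⟩
    · rintro y y' hyy' ⟨x, hx, hxy⟩
      exact ⟨x, hx, hxy.trans hyy'⟩
  obtain ⟨J, hJ, -, hdisj⟩ := DistribLattice.prime_ideal_of_disjoint_filter_ideal
    (F := hF.toPFilter) (I := Order.Ideal.principal (⊥ : A.carrier)) (by
      rw [Set.disjoint_left]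
      rintro y ⟨x, hx, hxy⟩ hy
      have hx0 : x = ⊥ := le_bot_iff.1 (le_trans hxy (Order.Ideal.mem_principal.1 hy))
      exact h0 (hx0 ▸ hx))
  have htop : (⊤ : A.carrier) ∉ J := fun h => hJ.ne_top (Order.Ideal.top_of_top_mem h)
  refine ⟨⟨{x | x ∉ J}, ?_, ?_, ?_⟩, fun x hx hxJ =>
    Set.disjoint_left.1 hdisj ⟨x, hx, le_rfl⟩ hxJ⟩
  · rw [hone]
    exact htop
  · intro x y
    rw [hmul]
    constructor
    · exact fun h => ⟨fun hx => h (J.lower inf_le_left hx), fun hy => h (J.lower inf_le_right hy)⟩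
    · exact fun h hxy => (hJ.mem_or_mem hxy).elim h.1 h.2
  · intro x
    rw [hneg]
    constructor
    · exact fun h h' => h' (hJ.mem_or_compl_mem.resolve_right h)
    · intro h h'
      have hx : x ∈ J := not_not.1 h
      exact htop (by simpa using Order.Ideal.sup_mem hx h')

theorem exists_mem_notMem (hA : A.IsBoolean) {x y : A.carrier} (h : ¬ A.le x y) :
    ∃ w : UF A, x ∈ w.set ∧ y ∉ w.set := by
  obtain ⟨w, hw⟩ := exists_of_directed hA (S := {A.mul x (A.neg y)}) ⟨_, rfl⟩ (by
      obtain ⟨-, inst, -, hmul, -⟩ := hA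
      rintro _ rfl _ rfl
      exact ⟨_, rfl, by simp [CylAlg.le, hmul]⟩) (by
      obtain ⟨-, inst, -, hmul, hneg, hzero, hone⟩ := hA
      intro e
      apply h
      rw [Set.mem_singleton_iff, hmul, hneg, hzero] at e
      rw [CylAlg.le, hmul, inf_eq_left]
      exact disjoint_compl_right_iff.1 (disjoint_iff.2 e.symm))
  have := w.mul_mem.1 (hw rfl)
  exact ⟨w, this.1, w.neg_mem.1 this.2⟩

theorem zero_notMem (hA : A.IsBoolean) (w : UF A) : A.zero ∉ w.set := by
  intro h
  obtain ⟨-, inst, -, hmul, hneg, hzero, hone⟩ := hA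
  have : A.neg A.one ∈ w.set := by rwa [hneg, hone, compl_top, ← hzero]
  exact w.neg_mem.1 this w.one_mem

theorem eq_of_subset {w w' : UF A} (h : w.set ⊆ w'.set) : w = w' := by
  ext x
  refine ⟨fun hx => h hx, fun hx => ?_⟩
  by_contra hx'
  exact w'.neg_mem.1 (h (w.neg_mem.2 hx')) hx

theorem le_of_forall (hA : A.IsBoolean) {x y : A.carrier}
    (h : ∀ w : UF A, x ∈ w.set → y ∈ w.set) : A.le x y := by
  by_contra hn
  obtain ⟨w, hx, hy⟩ := exists_mem_notMem hA hn
  exact hy (h w hx)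

theorem eq_of_forall (hA : A.IsBoolean) {x y : A.carrier}
    (h : ∀ w : UF A, x ∈ w.set ↔ y ∈ w.set) : x = y := by
  have h1 := le_of_forall hA fun w => (h w).1
  have h2 := le_of_forall hA fun w => (h w).2
  obtain ⟨-, inst, -, hmul, -⟩ := hA
  rw [CylAlg.le, hmul, inf_eq_left] at h1 h2
  exact le_antisymm h1 h2

/-- Equivalence of ultrafilters with respect to the `i`-closed elements. -/
def rel (i : Fin n) (w w' : UF A) : Prop := ∀ x, A.c i x ∈ w.set ↔ A.c i x ∈ w'.set

theorem rel_equivalence (i : Fin n) : Equivalence (rel (A := A) i) where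
  refl _ _ := Iff.rfl
  symm h x := (h x).symm
  trans h h' x := (h x).trans (h' x)

theorem rel.c_mem {i : Fin n} {w w' : UF A} (h : rel i w w') (hA : A.IsRC) {x : A.carrier}
    (hx : x ∈ w'.set) : A.c i x ∈ w.set :=
  (h x).2 (w'.mono (hA.ax2 i x) hx)

end UF

namespace IsRC

variable {A : CylAlg.{u} n}

theorem le_trans (hA : A.IsRC) {x y z : A.carrier} (h : A.le x y) (h' : A.le y z) : A.le x z :=
  UF.le_of_forall hA.ax0 fun w hx => w.mono h' (w.mono h hx)

theorem c_mono (hA : A.IsRC) (i : Fin n) {x y : A.carrier} (h : A.le x y) : A.le (A.c i x)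
    (A.c i y) := by
  have : A.mul x (A.c i y) = x := hA.le_trans h (hA.ax2 i y)
  rw [CylAlg.le, ← hA.ax3, this]

theorem s_mono (hA : A.IsRC) (i j : Fin n) {x y : A.carrier} (h : A.le x y) : A.le (A.s i j x)
    (A.s i j y) := by
  unfold CylAlg.s
  split_ifs
  · exact h
  · refine hA.c_mono i (UF.le_of_forall hA.ax0 fun w hx => ?_)
    rw [w.mul_mem] at hx ⊢
    exact ⟨w.mono h hx.1, hx.2⟩

theorem c_c (hA : A.IsRC) (i : Fin n) (x : A.carrier) : A.c i (A.c i x) = A.c i x := by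
  have h1 : ∀ y, A.mul A.one y = y := fun y => UF.eq_of_forall hA.ax0 fun w => by
    simp [w.mul_mem, w.one_mem]
  have h2 : A.c i A.one = A.one := UF.eq_of_forall hA.ax0 fun w =>
    ⟨fun _ => w.one_mem, fun h => w.mono (hA.ax2 i _) h⟩
  have := hA.ax3 i A.one x
  rwa [h1, h2, h1] at this

theorem c_neg_c (hA : A.IsRC) (i : Fin n) (x : A.carrier) : A.c i (A.neg (A.c i x)) = A.neg
    (A.c i x) := by
  refine UF.eq_of_forall hA.ax0 fun w => ⟨fun h => w.neg_mem.2 fun hx => ?_, w.mono (hA.ax2 i _)⟩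
  have h0 : A.mul (A.neg (A.c i x)) (A.c i x) = A.zero := UF.eq_of_forall hA.ax0 fun w => by
    simp [w.mul_mem, w.neg_mem, w.zero_notMem hA.ax0]
  have := hA.ax3 i (A.neg (A.c i x)) x
  rw [h0, hA.ax1] at this
  exact w.zero_notMem hA.ax0 (this ▸ w.mul_mem.2 ⟨h, hx⟩)

/-- One inclusion suffices because the `c_i`-closed elements are closed under complement. -/
theorem rel_of_forall (hA : A.IsRC) {i : Fin n} {w w' : UF A}
    (h : ∀ x, A.c i x ∈ w.set → A.c i x ∈ w'.set) :
    UF.rel i w w' := by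
  refine fun x => ⟨h x, fun hx => ?_⟩
  by_contra hx'
  have := h (A.neg (A.c i x)) (by rw [hA.c_neg_c]; exact w.neg_mem.2 hx')
  rw [hA.c_neg_c] at this
  exact w'.neg_mem.1 this hx

theorem rel_of_forall_mem (hA : A.IsRC) {i : Fin n} {w w' : UF A}
    (h : ∀ x ∈ w.set, A.c i x ∈ w'.set) :
    UF.rel i w w' :=
  hA.rel_of_forall fun x hx => hA.c_c i x ▸ h _ hx

/-- By Ax3 and Ax1, `x` is compatible with all closed elements `c_i y` of `w`; an ultrafilter
containing them all is the required one. -/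
theorem exists_rel_of_c_mem (hA : A.IsRC) {i : Fin n} {w : UF A} {x : A.carrier}
    (hx : A.c i x ∈ w.set) :
    ∃ w', UF.rel i w w' ∧ x ∈ w'.set := by
  obtain ⟨w', hw'⟩ := UF.exists_of_directed hA.ax0
    (S := {z | ∃ y, A.c i y ∈ w.set ∧ z = A.mul x (A.c i y)}) ⟨_, x, hx, rfl⟩ (by
      rintro _ ⟨y, hy, rfl⟩ _ ⟨y', hy', rfl⟩
      refine ⟨_, ⟨A.mul y (A.c i y'), ?_, rfl⟩, UF.le_of_forall hA.ax0 fun w h => ?_⟩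
      · rw [hA.ax3]
        exact w.mul_mem.2 ⟨hy, hy'⟩
      · simp only [hA.ax3, w.mul_mem] at h ⊢
        tauto) (by
      rintro ⟨y, hy, e⟩
      have := hA.ax3 i x y
      rw [← e, hA.ax1] at this
      exact w.zero_notMem hA.ax0 (this ▸ w.mul_mem.2 ⟨hx, hy⟩))
  exact ⟨w', hA.rel_of_forall fun y hy => (w'.mul_mem.1 (hw' ⟨y, hy, rfl⟩)).2,
    (w'.mul_mem.1 (hw' ⟨x, hx, rfl⟩)).1⟩

theorem d_mem_of_rel (hA : A.IsRC) {i j k : Fin n} {w w' : UF A} (hi : k ≠ i) (hj : k ≠ j)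
    (h : UF.rel k w w')
    (hd : A.d i j ∈ w.set) : A.d i j ∈ w'.set := by
  rw [hA.ax5_cyl j i k hj hi] at hd ⊢
  exact (h _).1 hd

theorem eq_of_rel_of_d_mem (hA : A.IsRC) {i j : Fin n} {w w' : UF A} (hij : i ≠ j)
    (h : UF.rel i w w')
    (hw : A.d i j ∈ w.set) (hw' : A.d i j ∈ w'.set) : w = w' :=
  UF.eq_of_subset fun x hx => w'.mono (hA.ax6 i j x hij) (w'.mul_mem.2
    ⟨(h _).1 (w.mono (hA.ax2 i _) (w.mul_mem.2 ⟨hx, hw⟩)), hw'⟩)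

/-- Ax7 wants substitutions and cylindrifications to alternate, so each step is padded: a free
change becomes `s^k_k c_k`, and a substitution is preceded by `c_k` for an unoccupied place `k`. -/
theorem exists_word_mem (hA : A.IsRC) {i₀ : Fin n} {w₀ w : UF A} {τ : Fin n → Fin n}
    (h : MerryWord UF.rel (fun i j w => A.d i j ∈ w.set) i₀ w₀ τ w) :
    ∃ (m : ℕ) (i j k : ℕ → Fin n), replComp i j m = τ ∧
      (∀ t < m, ∀ l, l ≠ i₀ → replComp i j t l ≠ k t) ∧
      ∀ x ∈ w₀.set, A.word i j k x m ∈ w.set := by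
  have extend : ∀ {τ : Fin n → Fin n} {w w' : UF A} (a b c : Fin n),
      (∃ (m : ℕ) (i j k : ℕ → Fin n), replComp i j m = τ ∧
        (∀ t < m, ∀ l, l ≠ i₀ → replComp i j t l ≠ k t) ∧
        ∀ x ∈ w₀.set, A.word i j k x m ∈ w.set) → (∀ l, l ≠ i₀ → τ l ≠ c) →
      (∀ x ∈ w.set, A.s a b (A.c c x) ∈ w'.set) →
      ∃ (m : ℕ) (i j k : ℕ → Fin n), replComp i j m = repl a b ∘ τ ∧
        (∀ t < m, ∀ l, l ≠ i₀ → replComp i j t l ≠ k t) ∧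
        ∀ x ∈ w₀.set, A.word i j k x m ∈ w'.set := by
    rintro _ w w' a b c ⟨m, i, j, k, rfl, hk, hw⟩ hc hs
    have hcongr : ∀ t ≤ m,
        replComp (Function.update i m a) (Function.update j m b) t = replComp i j t := by
      intro t ht
      refine replComp_congr fun s hs => ?_
      simp [show s ≠ m by omega]
    refine ⟨m + 1, Function.update i m a, Function.update j m b, Function.update k m c, ?_, ?_, ?_⟩
    · simp [replComp, hcongr]
    · intro t ht l hl
      rw [hcongr t (by omega)]
      by_cases htm : t = m
      · subst htm
        simpa using hc l hl
      · simpa [htm] using hk t (by omega) l hl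
    · intro x hx
      have : A.word (Function.update i m a) (Function.update j m b) (Function.update k m c) x m =
          A.word i j k x m := A.word_congr fun s hs => by simp [show s ≠ m by omega]
      simp only [word, Function.update_self, this]
      exact hs _ (hw x hx)
  induction h with
  | nil => exact ⟨0, fun _ => i₀, fun _ => i₀, fun _ => i₀, rfl, by simp, fun x hx => hx⟩
  | @free τ w w' k _ hk hE ih =>
    have := extend (w' := w') k k k ih hk fun x hx => by
      simp only [CylAlg.s, if_true]
      exact ((UF.rel_equivalence k).symm hE).c_mem hA hx
    rwa [repl_self, Function.id_comp] at this
  | @subst τ w w' i j _ hij hd hE ih =>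
    -- At most `n - 1` places carry tokens, so a harmless `k` exists.
    obtain ⟨k, hk⟩ := Frame.exists_notMem_image (i₀ := i₀) τ Function.injective_id
    refine extend (w' := w') i j k ih (fun l hl e => hk ⟨l, hl, e⟩) fun x hx => ?_
    simp only [CylAlg.s, hij, if_false]
    exact ((UF.rel_equivalence i).symm hE).c_mem hA
      (w.mul_mem.2 ⟨w.mono (hA.ax2 k x) hx, hd⟩)

/-- The ultrafilter frame of an algebra. -/
def frame (hA : A.IsRC) : Frame n (UF A) where
  E := UF.rel
  D i j w := A.d i j ∈ w.set
  E_equiv := UF.rel_equivalence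
  D_equiv w :=
    { refl := fun i => by rw [hA.ax4]; exact w.one_mem
      symm := fun {i j} h => hA.ax5_symm i j ▸ h
      trans := fun {i k j} h h' => by
        by_cases hi : k = i
        · exact hi ▸ h'
        by_cases hj : k = j
        · exact hj ▸ h
        exact w.mono (hA.ax5_trans i j k hi hj) (w.mul_mem.2 ⟨h, h'⟩) }
  D_cyl := hA.d_mem_of_rel
  sub_unique := hA.eq_of_rel_of_d_mem
  merry := by
    intro i₀ w₀ τ w hτ hd
    obtain ⟨m, i, j, k, rfl, hk, hw⟩ := hA.exists_word_mem hτ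
    -- Ax7 needs `m ≥ 1`; the empty word gives `w₀ = w` outright.
    rcases Nat.eq_zero_or_pos m with rfl | hm
    · rw [UF.eq_of_subset hw]
      exact (UF.rel_equivalence _).refl _
    · refine hA.rel_of_forall_mem fun x hx => w.mono (hA.ax7 m i j k i₀ _ hm rfl ?_ x)
        (w.mul_mem.2 ⟨hw x hx, w.mem_prod.2 fun l hl => hd l (Finset.ne_of_mem_erase hl)⟩)
      intro t ht hmem
      obtain ⟨l, hl, e⟩ := Finset.mem_image.1 hmem
      exact hk t ht l (Finset.ne_of_mem_erase hl) e

theorem isRep (hA : A.IsRC) {U : Type v} {V : Set (Fin n → U)} {lab : (Fin n → U) → UF A}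
    (h : hA.frame.IsUnravelling V lab) : IsRep A V fun x => {f | f ∈ V ∧ x ∈ (lab f).set} where
  inj x y hxy := by
    refine UF.eq_of_forall hA.ax0 fun w => ?_
    obtain ⟨f, hf, rfl⟩ := h.surj w
    have := congrArg (f ∈ ·) hxy
    simpa [hf] using this
  sub x f hf := hf.1
  map_add x y := by
    have hadd : ∀ w : UF A, A.add x y ∈ w.set ↔ x ∈ w.set ∨ y ∈ w.set := by
      intro w
      have : A.add x y = A.neg (A.mul (A.neg x) (A.neg y)) := by
        obtain ⟨-, inst, h1, h2, h3, -⟩ := hA.ax0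
        simp [h1, h2, h3]
      rw [this, w.neg_mem, w.mul_mem, w.neg_mem, w.neg_mem]
      tauto
    ext f
    simp only [hadd, Set.mem_ofPred_eq, Set.mem_union]
    tauto
  map_mul x y := by
    ext f
    simp only [UF.mul_mem, Set.mem_ofPred_eq, Set.mem_inter_iff]
    tauto
  map_neg x := by
    ext f
    simp only [UF.neg_mem, Set.mem_ofPred_eq, Set.mem_sdiff]
    tauto
  map_zero := by
    ext f
    simp [UF.zero_notMem hA.ax0]
  map_one := by
    ext f
    simp [UF.one_mem]
  map_c i x := by
    ext f
    simp only [Set.mem_ofPred_eq]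
    refine and_congr_right fun hf => ⟨fun hx => ?_, ?_⟩
    · obtain ⟨w, hE, hw⟩ := hA.exists_rel_of_c_mem hx
      obtain ⟨g, hg, e, rfl⟩ := h.back f hf i w hE
      exact ⟨g, ⟨hg, hw⟩, e⟩
    · rintro ⟨g, ⟨hg, hx⟩, e⟩
      exact UF.rel.c_mem (h.forth f hf g hg i e) hA hx
  map_d i j := by
    ext f
    simp only [Set.mem_ofPred_eq]
    exact and_congr_right fun hf => (h.diag f hf i j).symm

/-- Ax6 makes the result of a substitution unique, so the witnesses for all the different `x`
coincide. -/
theorem exists_sub_of_s_mem (hA : A.IsRC) {i j : Fin n} (hij : i ≠ j) {w : UF A}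
    (h : ∃ w', hA.frame.Sub i j w w') :
    ∃ w', hA.frame.Sub i j w w' ∧ ∀ x, A.s i j x ∈ w.set → x ∈ w'.set := by
  obtain ⟨w', hw'⟩ := h
  refine ⟨w', hw', fun x hx => ?_⟩
  simp only [CylAlg.s, hij, if_false] at hx
  obtain ⟨w'', hE, hx⟩ := hA.exists_rel_of_c_mem hx
  have : w'' = w' := hA.eq_of_rel_of_d_mem hij
    ((UF.rel_equivalence i).trans ((UF.rel_equivalence i).symm hE) hw'.1) (w''.mul_mem.1 hx).2 hw'.2
  exact this ▸ (w''.mul_mem.1 hx).1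

theorem nonempty_uf (hA : A.IsRC) : Nonempty (UF A) := by
  obtain ⟨w, -⟩ := UF.exists_mem_notMem hA.ax0 (x := A.one) (y := A.zero) (by
    obtain ⟨hne, inst, -, hmul, -, hzero, hone⟩ := hA.ax0
    intro h
    rw [CylAlg.le, hmul, hzero, hone, top_inf_eq] at h
    exact hne (hzero.trans (h.trans hone.symm)))
  exact ⟨w⟩

end IsRC

theorem IsDC.exists_sub {A : CylAlg.{u} n} (hA : A.IsDC) (i j : Fin n) (hij : i ≠ j) (w : UF A) :
    ∃ w', hA.toIsRC.frame.Sub i j w w' := by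
  -- With equal outer indices, Ax9 says `1 = c_i (d_ji · d_ij)`.
  have h := hA.ax9 j j i hij hij
  rw [hA.ax4] at h
  obtain ⟨w', hE, hw'⟩ := hA.toIsRC.exists_rel_of_c_mem (h ▸ w.one_mem)
  exact ⟨w', hE, (w'.mul_mem.1 hw').2⟩

/-! ### Interchanged worlds from axioms 11 and 12 -/

namespace IsSC

variable {A : CylAlg.{u} n}

theorem isSwap (hA : A.IsSC) {i j : Fin n} (hij : i ≠ j) {w u : UF A}
    (h1 : ∀ x ∈ w.set, A.s i j (A.c j x) ∈ u.set) (h2 : ∀ x ∈ w.set, A.s j i (A.c i x) ∈ u.set)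
    (h3 : ∀ k, k ≠ i → k ≠ j → ∀ x ∈ w.set, A.s k i (A.s i j (A.s j k (A.c k x))) ∈ u.set) :
    hA.toIsRC.frame.IsSwap i j w u := by
  have sub : ∀ (i j : Fin n), i ≠ j → ∀ u : UF A, ∃ w', hA.toIsRC.frame.Sub i j u w' ∧
      ∀ x, A.s i j x ∈ u.set → x ∈ w'.set := fun i j hij u =>
    hA.toIsRC.exists_sub_of_s_mem hij (hA.toIsDC.exists_sub i j hij u)
  have close : ∀ (i : Fin n) (u' : UF A), (∀ x ∈ w.set, A.c i x ∈ u'.set) →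
      hA.toIsRC.frame.E i u' w := fun i u' h =>
    (UF.rel_equivalence i).symm (hA.toIsRC.rel_of_forall_mem h)
  refine ⟨?_, ?_, fun k hki hkj => ?_⟩
  · obtain ⟨u', hs, hu'⟩ := sub i j hij u
    exact ⟨u', hs, close j u' fun x hx => hu' _ (h1 x hx)⟩
  · obtain ⟨u', hs, hu'⟩ := sub j i hij.symm u
    exact ⟨u', hs, close i u' fun x hx => hu' _ (h2 x hx)⟩
  · obtain ⟨u₁, hs₁, hu₁⟩ := sub k i hki u
    obtain ⟨u₂, hs₂, hu₂⟩ := sub i j hij u₁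
    obtain ⟨u₃, hs₃, hu₃⟩ := sub j k hkj.symm u₂
    exact ⟨u₁, u₂, u₃, hs₁, hs₂, hs₃,
      close k u₃ fun x hx => hu₃ _ (hu₂ _ (hu₁ _ (h3 k hki hkj x hx)))⟩

/-- Monotonicity makes the image of `w` under `F` a filter base, and it omits `0` because `c_i c_j 0
= 0` is not in `w`. -/
theorem exists_mem_of_mono (hA : A.IsSC) (w : UF A) (F : A.carrier → A.carrier) (i j : Fin n)
    (hmono : ∀ x y, A.le x y → A.le (F x) (F y)) (hF : ∀ x ∈ w.set, A.c i (A.c j (F x)) ∈ w.set) :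
    ∃ u : UF A, ∀ x ∈ w.set, F x ∈ u.set := by
  have hle : ∀ x y, A.le (A.mul x y) x ∧ A.le (A.mul x y) y := fun x y =>
    ⟨UF.le_of_forall hA.ax0 fun u h => (u.mul_mem.1 h).1,
      UF.le_of_forall hA.ax0 fun u h => (u.mul_mem.1 h).2⟩
  obtain ⟨u, hu⟩ := UF.exists_of_directed hA.ax0 (S := F '' w.set) ⟨_, _, w.one_mem, rfl⟩ (by
      rintro _ ⟨x, hx, rfl⟩ _ ⟨y, hy, rfl⟩
      exact ⟨_, ⟨_, w.mul_mem.2 ⟨hx, hy⟩, rfl⟩, UF.le_of_forall hA.ax0 fun u h =>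
        u.mul_mem.2 ⟨u.mono (hmono _ _ (hle x y).1) h, u.mono (hmono _ _ (hle x y).2) h⟩⟩) (by
      rintro ⟨x, hx, e⟩
      have := hF x hx
      rw [e, hA.ax1, hA.ax1] at this
      exact w.zero_notMem hA.ax0 this)
  exact ⟨u, fun x hx => hu ⟨x, hx, rfl⟩⟩

/-- An identification in `u` is transported along one of the paths of `IsSwap` to an identification
in `w`. -/
theorem distinct_of_isSwap (hA : A.IsSC) (hn : 3 ≤ n) {i j : Fin n} (hij : i ≠ j) {w u : UF A}
    (hw : hA.toIsRC.frame.Distinct w) (h : hA.toIsRC.frame.IsSwap i j w u) :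
    hA.toIsRC.frame.Distinct u := by
  set F := hA.toIsRC.frame
  obtain ⟨u₁, hs₁, hE₁⟩ := h.left
  obtain ⟨u₂, hs₂, hE₂⟩ := h.right
  have symm : ∀ {a b} {w : UF A}, F.D a b w → F.D b a w := fun {_ _ w} h => (F.D_equiv w).symm h
  have hi : ∀ b, b ≠ i → b ≠ j → ¬ F.D i b u := fun b hbi hbj hD =>
    hbj (hw _ _ (F.D_cyl hij (Ne.symm hbi) hE₂
      ((F.D_equiv u₂).trans hs₂.2 (F.D_cyl hij.symm (Ne.symm hbj) hs₂.1 hD)))).symm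
  have hj : ∀ b, b ≠ i → b ≠ j → ¬ F.D j b u := fun b hbi hbj hD =>
    hbi (hw _ _ (F.D_cyl hij.symm (Ne.symm hbj) hE₁
      ((F.D_equiv u₁).trans hs₁.2 (F.D_cyl hij (Ne.symm hbi) hs₁.1 hD)))).symm
  -- A third coordinate `k` is essential: if `u` identifies `i` and `j`, the last two substitutions
  -- on the path through `k` change nothing, and `w` would identify `i` and `j` as well.
  have hij' : ¬ F.D i j u := by
    intro hD
    obtain ⟨k, hk⟩ : ∃ k, k ∉ ({i, j} : Finset (Fin n)) := by
      by_contra! hall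
      have h1 := Finset.card_le_card fun k (_ : k ∈ Finset.univ) => hall k
      have h2 := Finset.card_le_two (a := i) (b := j)
      rw [Finset.card_univ, Fintype.card_fin] at h1
      omega
    simp only [Finset.mem_insert, Finset.mem_singleton, not_or] at hk
    obtain ⟨hki, hkj⟩ := hk
    obtain ⟨v₁, v₂, v₃, h₁, h₂, h₃, hE⟩ := h.other k hki hkj
    have e₁ : F.D i j v₁ := F.D_cyl hki hkj h₁.1 hD
    have e₂ : v₁ = v₂ := F.sub_unique hij h₂.1 e₁ h₂.2
    subst e₂
    have e₃ : F.D j k v₁ := symm ((F.D_equiv v₁).trans h₁.2 e₁)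
    have e₄ : v₁ = v₃ := F.sub_unique (Ne.symm hkj) h₃.1 e₃ h₃.2
    subst e₄
    exact hij (hw _ _ (F.D_cyl hki hkj hE e₁))
  intro a b hD
  by_contra hab
  by_cases hai : a = i
  · subst hai
    by_cases hbj : b = j
    · exact hij' (hbj ▸ hD)
    · exact hi b (Ne.symm hab) hbj hD
  by_cases haj : a = j
  · subst haj
    by_cases hbi : b = i
    · exact hij' (hbi ▸ symm hD)
    · exact hj b hbi (Ne.symm hab) hD
  by_cases hbi : b = i
  · exact hi a hai haj (hbi ▸ symm hD)
  by_cases hbj : b = j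
  · exact hj a hai haj (hbj ▸ symm hD)
  exact hab (hw _ _ (F.D_cyl (Ne.symm haj) (Ne.symm hbj) hE₁
    (F.D_cyl (Ne.symm hai) (Ne.symm hbi) hs₁.1 hD)))

theorem exists_isSwap_of_three_le (hA : A.IsSC) (hn : 3 ≤ n) {i j : Fin n} (hij : i ≠ j)
    (w : UF A) :
    ∃ u, hA.toIsRC.frame.IsSwap i j w u := by
  have sc : ∀ a b c {x y}, A.le x y → A.le (A.s a b (A.c c x)) (A.s a b (A.c c y)) :=
    fun a b c {x y} h => hA.s_mono a b (hA.c_mono c h)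
  obtain ⟨u, hu⟩ := hA.exists_mem_of_mono w (fun x => A.mul (A.mul (A.s i j (A.c j x))
    (A.s j i (A.c i x))) (A.prod (Finset.univ.filter fun k => k ≠ i ∧ k ≠ j)
      fun k => A.s k i (A.s i j (A.s j k (A.c k x))))) i j (by
      refine fun x y hxy => UF.le_of_forall hA.ax0 fun u h => ?_
      simp only [u.mul_mem, u.mem_prod] at h ⊢
      exact ⟨⟨u.mono (sc _ _ _ hxy) h.1.1, u.mono (sc _ _ _ hxy) h.1.2⟩, fun k hk =>
        u.mono (hA.s_mono _ _ (hA.s_mono _ _ (sc _ _ _ hxy))) (h.2 k hk)⟩)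
    fun x hx => w.mono (hA.ax12 hn i j x) hx
  simp only [u.mul_mem, u.mem_prod] at hu
  exact ⟨u, hA.isSwap hij (fun x hx => (hu x hx).1.1) (fun x hx => (hu x hx).1.2)
    fun k hki hkj x hx => (hu x hx).2 k (by simp [hki, hkj])⟩

/-- There is no third coordinate here, so distinctness of `u` comes from the factor `-d_01` in Ax11.
The condition being symmetric, the same `u` serves for both orders of the pair. -/
theorem exists_isSwap_of_eq_two (hA : A.IsSC) (hn : n = 2) {i j : Fin n} (hi : (i : ℕ) = 0)
    (hj : (j : ℕ) = 1)
    {w : UF A} (hw : hA.toIsRC.frame.Distinct w) :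
    ∃ u, hA.toIsRC.frame.Distinct u ∧ hA.toIsRC.frame.IsSwap i j w u ∧
      hA.toIsRC.frame.IsSwap j i w u := by
  have hij : i ≠ j := fun e => by rw [e] at hi; omega
  have two : ∀ k : Fin n, k = i ∨ k = j := fun k => by
    have := k.isLt
    rcases (by omega : (k : ℕ) = 0 ∨ (k : ℕ) = 1) with h | h
    · exact .inl (Fin.ext (h.trans hi.symm))
    · exact .inr (Fin.ext (h.trans hj.symm))
  have sc : ∀ a b c {x y}, A.le x y → A.le (A.s a b (A.c c x)) (A.s a b (A.c c y)) :=
    fun a b c {x y} h => hA.s_mono a b (hA.c_mono c h)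
  obtain ⟨u, hu⟩ := hA.exists_mem_of_mono w (fun x => A.mul (A.mul (A.neg (A.d i j))
    (A.s i j (A.c j x))) (A.s j i (A.c i x))) i j (by
      refine fun x y hxy => UF.le_of_forall hA.ax0 fun u h => ?_
      simp only [u.mul_mem] at h ⊢
      exact ⟨⟨h.1.1, u.mono (sc _ _ _ hxy) h.1.2⟩, u.mono (sc _ _ _ hxy) h.2⟩)
    fun x hx => w.mono (hA.ax11 hn i j hi hj x)
      (w.mul_mem.2 ⟨hx, w.neg_mem.2 fun hd => hij (hw _ _ hd)⟩)
  simp only [u.mul_mem] at hu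
  have hd : ¬ hA.toIsRC.frame.D i j u := u.neg_mem.1 (hu _ w.one_mem).1.1
  refine ⟨u, fun a b hD => ?_,
    hA.isSwap hij (fun x hx => (hu x hx).1.2) (fun x hx => (hu x hx).2)
      fun k hki hkj => ((two k).elim hki hkj).elim,
    hA.isSwap hij.symm (fun x hx => (hu x hx).2) (fun x hx => (hu x hx).1.2)
      fun k hkj hki => ((two k).elim hki hkj).elim⟩
  rcases two a with rfl | rfl <;> rcases two b with rfl | rfl
  · rfl
  · exact (hd hD).elim
  · exact (hd ((hA.toIsRC.frame.D_equiv u).symm hD)).elim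
  · rfl

theorem exists_distinct_isSwap (hA : A.IsSC) (hn : 2 ≤ n) (i j : Fin n) (hij : i ≠ j) (w : UF A)
    (hw : hA.toIsRC.frame.Distinct w) :
    ∃ u, hA.toIsRC.frame.Distinct u ∧ hA.toIsRC.frame.IsSwap i j w u := by
  rcases hn.eq_or_lt with hn | hn
  · have hi := i.isLt
    have hj := j.isLt
    have hne : (i : ℕ) ≠ j := fun e => hij (Fin.ext e)
    rcases (by omega : (i : ℕ) = 0 ∧ (j : ℕ) = 1 ∨ (j : ℕ) = 0 ∧ (i : ℕ) = 1) with
      ⟨h0, h1⟩ | ⟨h0, h1⟩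
    · obtain ⟨u, hu, h, -⟩ := hA.exists_isSwap_of_eq_two hn.symm h0 h1 hw
      exact ⟨u, hu, h⟩
    · obtain ⟨u, hu, -, h⟩ := hA.exists_isSwap_of_eq_two hn.symm h0 h1 hw
      exact ⟨u, hu, h⟩
  · obtain ⟨u, hu⟩ := hA.exists_isSwap_of_three_le hn hij w
    exact ⟨u, hA.distinct_of_isSwap hn hij hw hu, hu⟩

end IsSC

end CylAlg

/-! ### The representation theorems -/

theorem mainTheorem1 (n : ℕ) (hn : 2 ≤ n) :
    CylAlg.RC.{u} n = CylAlg.isoCopies.{u, max u v} (CylAlg.RCs.{max u v} n) ∧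
    CylAlg.DC.{u} n = CylAlg.isoCopies.{u, max u v} (CylAlg.DCs.{max u v} n) ∧
    CylAlg.SC.{u} n = CylAlg.isoCopies.{u, max u v} (CylAlg.SCs.{max u v} n) := by
  have nonempty : ∀ {A : CylAlg.{u} n} (hA : A.IsRC) {U : Type max u v} {V : Set (Fin n → U)}
      {lab : (Fin n → U) → CylAlg.UF A}, hA.frame.IsUnravelling V lab → V.Nonempty := by
    intro A hA U V lab h
    obtain ⟨w⟩ := hA.nonempty_uf
    obtain ⟨f, hf, -⟩ := h.surj w
    exact ⟨f, hf⟩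
  refine ⟨?_, ?_, ?_⟩
  · ext A
    have key := CylAlg.mem_isoCopies_iff.{u, max u v} (fun _ _ => True) A
    simp only [true_and] at key
    refine Iff.trans ?_ key.symm
    constructor
    · intro (hA : A.IsRC)
      have : Inhabited (CylAlg.UF A) := Classical.inhabited_of_nonempty hA.nonempty_uf
      obtain ⟨U, V, lab, h⟩ := hA.frame.exists_isUnravelling.{u, v} hn
      exact ⟨U, V, nonempty hA h, _, hA.isRep h⟩
    · rintro ⟨U, V, hV, Φ, h⟩
      exact h.isRC hV
  · ext A
    refine Iff.trans ?_
      (CylAlg.mem_isoCopies_iff.{u, max u v} (fun _ V => CylAlg.Diagonalizable V) A).symm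
    constructor
    · intro (hA : A.IsDC)
      have : Inhabited (CylAlg.UF A) := Classical.inhabited_of_nonempty hA.nonempty_uf
      obtain ⟨U, V, lab, h⟩ := hA.frame.exists_isUnravelling.{u, v} hn
      exact ⟨U, V, nonempty hA.toIsRC h, h.diagonalizable hA.exists_sub, _, hA.isRep h⟩
    · rintro ⟨U, V, hV, hD, Φ, h⟩
      exact h.isDC hV hD
  · ext A
    have key := CylAlg.mem_isoCopies_iff.{u, max u v}
      (fun _ V => CylAlg.Diagonalizable V ∧ CylAlg.Permutable V) A
    simp only [and_assoc] at key
    refine Iff.trans ?_ key.symm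
    constructor
    · intro (hA : A.IsSC)
      have : Inhabited (CylAlg.UF A) := Classical.inhabited_of_nonempty hA.nonempty_uf
      obtain ⟨U, V, lab, h, hP⟩ := hA.frame.exists_isUnravelling_permutable.{u, v} hn
        hA.exists_sub (hA.exists_distinct_isSwap hn)
      exact ⟨U, V, nonempty hA.toIsRC h, h.diagonalizable hA.exists_sub, hP, _, hA.isRep h⟩
    · rintro ⟨U, V, hV, hD, hP, Φ, h⟩
      exact h.isSC hV hD hP
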